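/- A $\mathbb{Z}$-grading of a $C^*$-algebra $A$ is a family $(A_n)_{n\in\mathbb{Z}}$ of closed subspaces of $A$ such that $A_mA_n\subseteq A_{m+n}$ and $A_{-n}=A_n^*$ for all $m,n$ (so that $A_0$ is a $C^*$-subalgebra), $A=\overline{\operatorname{span}}\bigcup_n A_n$, and there is a positive norm-decreasing linear map $E:A\to A_0$ that is the identity on $A_0$ and vanishes on $A_n$ for $n\neq 0$. The grading is strong if $\overline{\operatorname{span}}\,A_mA_n=A_{m+n}$ for all $m,n\in\mathbb{Z}$. Let $X$ be a $C^*$-correspondence over a $C^*$-algebra $\mathcal{A}$, that is, a right-Hilbert $\mathcal{A}$-module with a left action $\phi$ of $\mathcal{A}$ by adjointable operators. Write $\theta_{x,y}(z)=x\cdot\langle y,z\rangle_{\mathcal{A}}$ and $\mathcal{K}(X)=\overline{\operatorname{span}}\{\theta_{x,y}: x,y\in X\}$. The left action is compact if $\phi(\mathcal{A})\subseteq\mathcal{K}(X)$ and nondegenerate if $\mathcal{A}\cdot X$ densely spans $X$; and $X$ is full if the inner products densely span $\mathcal{A}$. A representation of $X$ in a $C^*$-algebra $B$ is a pair $(\pi,\psi)$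 of a $*$-homomorphism $\pi:\mathcal{A}\to B$ and a linear map $\psi:X\to B$ with $\psi(a\cdot x)=\pi(a)\psi(x)$, $\psi(x\cdot a)=\psi(x)\pi(a)$ and $\pi(\langle x,y\rangle_{\mathcal{A}})=\psi(x)^*\psi(y)$. It induces a homomorphism $\pi^{(1)}:\mathcal{K}(X)\to B$ with $\pi^{(1)}(\theta_{x,y})=\psi(x)\psi(y)^*$. If the left action on $X$ is compact and injective, the representation is covariant if $\pi^{(1)}\circ\phi=\pi$, and the Cuntz--Pimsner algebra $\mathcal{O}_X$ is the universal $C^*$-algebra generated by the image of a covariant representation $(j_{\mathcal{A}},j_X)$ of $X$. Lemma. Let $A$ be a strongly $\mathbb{Z}$-graded $C^*$-algebra with graded subspaces $A_n$. Let $\mathcal{A}\subseteq A_0$ be a $\sigma$-unital $C^*$-subalgebra and let $X\subseteq A_1$ be a closed subspace such that 1. $X\mathcal{A}\subseteq X$ and $\overline{\operatorname{span}}\,\mathcal{A}X=X$, 2. $\mathcal{A}=\overline{\operatorname{span}}\{x^*y: x,y\in X\}$, 3. $\overline{\operatorname{span}}\{xy^*: x,y\in X\}$ contains an approximate identity for $\mathcal{A}$,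 and 4. $A_1\subseteq C^*(X)$, the $C^*$-subalgebra of $A$ generated by $X$. Then, with respect to the actions of $\mathcal{A}$ by left and right multiplication and the inner product $\langle x,y\rangle_{\mathcal{A}}=x^*y$, the space $X$ is a nondegenerate full $C^*$-correspondence over $\mathcal{A}$ with compact injective left action, and there is a unique isomorphism $\Psi:A\cong\mathcal{O}_X$ of $C^*$-algebras such that $\Psi|_X=j_X$ and $\Psi|_{\mathcal{A}}=j_{\mathcal{A}}$. -/

import Mathlib

open Filter Topology
open scoped ENNReal CStarAlgebra

universe u v

noncomputable section

/-! ### C*-algebraic preliminaries -/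

/-- Positive elements of a C*-algebra: those of the form `b* b`. -/
def CStarPos {A : Type*} [NonUnitalCStarAlgebra A] (a : A) : Prop :=
  ∃ b : A, a = star b * b

/-- A C*-algebra is σ-unital if it has a sequential approximate identity. -/
def SigmaUnital (A : Type*) [NonUnitalCStarAlgebra A] : Prop :=
  ∃ e : ℕ → A, (Filter.map e atTop).IsApproximateUnit

/-- `clspMul S T` is the closed linear span of the products `s * t`, `s ∈ S`, `t ∈ T`. -/
def clspMul {A : Type*} [NonUnitalCStarAlgebra A] (S T : Set A) : Submodule ℂ A :=
  (Submodule.span ℂ {a : A | ∃ s ∈ S, ∃ t ∈ T, a = s * t}).topologicalClosure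

/-- `C*(S)`: the C*-subalgebra generated by a subset. -/
def cstarGen {A : Type*} [NonUnitalCStarAlgebra A] (S : Set A) : NonUnitalStarSubalgebra ℂ A :=
  (NonUnitalStarAlgebra.adjoin ℂ S).topologicalClosure

instance cstarGen_isClosed {A : Type*} [NonUnitalCStarAlgebra A] (S : Set A) :
    IsClosed (cstarGen S : Set A) :=
  NonUnitalStarSubalgebra.isClosed_topologicalClosure _

/-- A `ℤ`-grading of a C*-algebra `A`, with graded subspaces `𝒢 n`. (The multiplication and
adjoint conditions make the closed subspace `𝒢 0` a C*-subalgebra.) -/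
structure IsCStarGrading {A : Type*} [NonUnitalCStarAlgebra A] (𝒢 : ℤ → Submodule ℂ A) :
    Prop where
  isClosed : ∀ n, IsClosed (𝒢 n : Set A)
  mul_mem : ∀ m n, ∀ a ∈ 𝒢 m, ∀ b ∈ 𝒢 n, a * b ∈ 𝒢 (m + n)
  star_mem_iff : ∀ n, ∀ a : A, a ∈ 𝒢 (-n) ↔ star a ∈ 𝒢 n
  dense : (⨆ n, 𝒢 n).topologicalClosure = ⊤
  exists_expectation : ∃ E : A →ₗ[ℂ] A,
    (∀ a, E a ∈ 𝒢 0) ∧ (∀ a, CStarPos a → CStarPos (E a)) ∧ (∀ a, ‖E a‖ ≤ ‖a‖) ∧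
    (∀ a ∈ 𝒢 0, E a = a) ∧ ∀ n, n ≠ 0 → ∀ a ∈ 𝒢 n, E a = 0

/-- A strong `ℤ`-grading: a grading such that `A_m A_n` densely spans `A_{m+n}`. -/
structure IsStrongCStarGrading {A : Type*} [NonUnitalCStarAlgebra A]
    (𝒢 : ℤ → Submodule ℂ A) : Prop extends IsCStarGrading 𝒢 where
  strong : ∀ m n, clspMul (𝒢 m : Set A) (𝒢 n : Set A) = 𝒢 (m + n)

/-! ### C*-correspondences -/

/-- A C*-correspondence structure over the C*-algebra `R` on the normed space `X`: a complete
right-Hilbert `R`-module whose norm is that of the inner product, with a left action of `R` by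
adjointable operators. Here `right x a` is `x · a`, `left a x` is `a · x`, and the `R`-valued inner
product is conjugate-linear in the first and linear in the second variable. -/
structure Correspondence (R X : Type*) [NonUnitalCStarAlgebra R] [NormedAddCommGroup X]
    [NormedSpace ℂ X] where
  right : X →ₗ[ℂ] R →ₗ[ℂ] X
  right_mul : ∀ x a b, right x (a * b) = right (right x a) b
  inner : X →ₗ⋆[ℂ] X →ₗ[ℂ] R
  inner_right : ∀ x y a, inner x (right y a) = inner x y * a
  star_inner : ∀ x y, star (inner x y) = inner y x
  inner_self_pos : ∀ x, CStarPos (inner x x)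
  inner_self_eq_zero : ∀ x, inner x x = 0 → x = 0
  norm_sq : ∀ x, ‖x‖ ^ 2 = ‖inner x x‖
  complete : CompleteSpace X
  left : R →ₗ[ℂ] X →L[ℂ] X
  left_mul : ∀ a b x, left (a * b) x = left a (left b x)
  left_right : ∀ a x b, left a (right x b) = right (left a x) b
  inner_left : ∀ a x y, inner (left a x) y = inner x (left (star a) y)

namespace Correspondence

section basic

variable {R X : Type*} [NonUnitalCStarAlgebra R] [NormedAddCommGroup X] [NormedSpace ℂ X]
  (C : Correspondence R X)

theorem norm_inner_le (x y : X) : ‖C.inner x y‖ ≤ ‖x‖ * ‖y‖ := by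
  let _ : PartialOrder Rᵐᵒᵖ := CStarAlgebra.spectralOrder _
  have _ : StarOrderedRing Rᵐᵒᵖ := CStarAlgebra.spectralOrderedRing _
  let _ : SMul Rᵐᵒᵖ X := ⟨fun a x => C.right x a.unop⟩
  let _ : CStarModule Rᵐᵒᵖ X :=
    { inner := fun x y => MulOpposite.op (C.inner x y)
      inner_add_right := by intros; simp
      inner_self_nonneg := by
        intro x
        obtain ⟨b, hb⟩ := C.inner_self_pos x
        rw [hb]
        exact mul_star_self_nonneg (MulOpposite.op b)
      inner_self := by
        intro x
        rw [MulOpposite.op_eq_zero_iff]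
        exact ⟨C.inner_self_eq_zero x, fun h => by simp [h]⟩
      inner_op_smul_right := by
        intro a x y
        apply MulOpposite.unop_injective
        exact C.inner_right x y a.unop
      inner_smul_right_complex := by intros; simp
      star_inner := by
        intro x y
        apply MulOpposite.unop_injective
        exact C.star_inner x y
      norm_eq_sqrt_norm_inner_self := by
        intro x
        rw [MulOpposite.norm_op, ← C.norm_sq, Real.sqrt_sq (norm_nonneg x)] }
  exact CStarModule.norm_inner_le (A := Rᵐᵒᵖ) X (x := x) (y := y)

theorem norm_right_le (x : X) (a : R) : ‖C.right x a‖ ≤ ‖x‖ * ‖a‖ := by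
  have h : ‖C.right x a‖ ^ 2 ≤ (‖x‖ * ‖a‖) ^ 2 := by
    have h1 : C.inner (C.right x a) (C.right x a) = star a * C.inner x x * a := by
      rw [C.inner_right, ← C.star_inner, C.inner_right, star_mul, C.star_inner]
    rw [C.norm_sq, h1]
    calc ‖star a * C.inner x x * a‖ ≤ ‖star a‖ * ‖C.inner x x‖ * ‖a‖ :=
          (norm_mul_le _ _).trans (by gcongr; exact norm_mul_le _ _)
      _ = (‖x‖ * ‖a‖) ^ 2 := by rw [norm_star, ← C.norm_sq]; ring
  exact (pow_le_pow_iff_left₀ (norm_nonneg _) (by positivity) two_ne_zero).mp h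

/-- The rank-one operator `θ_{x,y} : z ↦ x · ⟨y, z⟩`. -/
def theta (x y : X) : X →L[ℂ] X :=
  LinearMap.mkContinuous ((C.right x).comp (C.inner y)) (‖x‖ * ‖y‖) fun z =>
    (C.norm_right_le x _).trans <| by
      rw [mul_assoc]; gcongr; exact C.norm_inner_le y z

theorem theta_apply (x y z : X) : C.theta x y z = C.right x (C.inner y z) := rfl

/-- The compact operators `𝒦(X)`: the closed linear span of the operators `θ_{x,y}`. -/
def compacts : Submodule ℂ (X →L[ℂ] X) :=
  (Submodule.span ℂ {T | ∃ x y, T = C.theta x y}).topologicalClosure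

instance : IsBoundedSMul ℂ C.compacts :=
  (Submodule.normedSpace (R := ℂ) C.compacts).toIsBoundedSMul

/-- The left action is by compact operators. -/
def CompactLeftAction : Prop := ∀ a, C.left a ∈ C.compacts

/-- The left action is injective. -/
def InjectiveLeftAction : Prop := ∀ a, C.left a = 0 → a = 0

/-- The left action is nondegenerate: `R · X` densely spans `X`. -/
def Nondegenerate : Prop :=
  (Submodule.span ℂ {z | ∃ a x, z = C.left a x}).topologicalClosure = ⊤

/-- The right-Hilbert module is full: the inner products densely span `R`. -/
def Full : Prop :=
  (Submodule.span ℂ {a | ∃ x y, a = C.inner x y}).topologicalClosure = ⊤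

end basic

/-! ### Representations and the Cuntz–Pimsner algebra -/

/-- A representation `(π, ψ)` of a C*-correspondence in a C*-algebra `B`. -/
structure Rep {R X : Type*} [NonUnitalCStarAlgebra R] [NormedAddCommGroup X] [NormedSpace ℂ X]
    (C : Correspondence R X) (B : Type v) [NonUnitalCStarAlgebra B] where
  π : R →⋆ₙₐ[ℂ] B
  ψ : X →ₗ[ℂ] B
  map_left : ∀ a x, ψ (C.left a x) = π a * ψ x
  map_right : ∀ x a, ψ (C.right x a) = ψ x * π a
  map_inner : ∀ x y, π (C.inner x y) = star (ψ x) * ψ y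

namespace Rep

variable {R X : Type*} [NonUnitalCStarAlgebra R] [NormedAddCommGroup X] [NormedSpace ℂ X]
  {C : Correspondence R X} {B : Type v} [NonUnitalCStarAlgebra B] (ρ : C.Rep B)

theorem norm_π_le (a : R) : ‖ρ.π a‖ ≤ ‖a‖ := NonUnitalStarAlgHom.norm_apply_le ρ.π a

theorem norm_ψ_le (x : X) : ‖ρ.ψ x‖ ≤ ‖x‖ := by
  have h : ‖ρ.ψ x‖ ^ 2 ≤ ‖x‖ ^ 2 := by
    rw [C.norm_sq, sq, ← CStarRing.norm_star_mul_self, ← ρ.map_inner]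
    exact ρ.norm_π_le _
  exact (pow_le_pow_iff_left₀ (norm_nonneg _) (norm_nonneg _) two_ne_zero).mp h

/-- The linear relation spanned by the pairs `(θ_{x,y}, ψ(x) ψ(y)*)`; it is the graph of the
restriction of `π⁽¹⁾` to the finite-rank operators. -/
def graph : Submodule ℂ ((X →L[ℂ] X) × B) :=
  Submodule.span ℂ {p | ∃ x y, p = (C.theta x y, ρ.ψ x * star (ρ.ψ y))}

theorem graph_mul_ψ {p : (X →L[ℂ] X) × B} (hp : p ∈ ρ.graph) (z : X) :
    p.2 * ρ.ψ z = ρ.ψ (p.1 z) := by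
  induction hp using Submodule.span_induction with
  | mem p hp =>
    obtain ⟨x, y, rfl⟩ := hp
    simp only [theta_apply]
    rw [ρ.map_right, ρ.map_inner, mul_assoc]
  | zero => simp
  | add p q _ _ hp hq => simp [add_mul, hp, hq]
  | smul c p _ hp => simp [smul_mul_assoc, hp]

theorem graph_star {p : (X →L[ℂ] X) × B} (hp : p ∈ ρ.graph) :
    ∃ q ∈ ρ.graph, q.2 = star p.2 ∧ ∀ x y, C.inner (p.1 x) y = C.inner x (q.1 y) := by
  induction hp using Submodule.span_induction with
  | mem p hp =>
    obtain ⟨x, y, rfl⟩ := hp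
    refine ⟨_, Submodule.subset_span ⟨y, x, rfl⟩, by simp, fun z w => ?_⟩
    simp only [theta_apply]
    rw [C.inner_right, ← C.star_inner, C.inner_right, star_mul, C.star_inner, C.star_inner]
  | zero => exact ⟨0, zero_mem _, by simp, by simp⟩
  | add p q _ _ hp hq =>
    obtain ⟨p', hp', h1, h2⟩ := hp
    obtain ⟨q', hq', h3, h4⟩ := hq
    exact ⟨p' + q', add_mem hp' hq', by simp [h1, h3], by simp [h2, h4]⟩
  | smul c p _ hp =>
    obtain ⟨p', hp', h1, h2⟩ := hp
    exact ⟨star c • p', Submodule.smul_mem _ _ hp', by simp [h1], by simp [h2]⟩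

theorem graph_mul {p q : (X →L[ℂ] X) × B} (hp : p ∈ ρ.graph) (hq : q ∈ ρ.graph) :
    p * q ∈ ρ.graph := by
  induction hq using Submodule.span_induction with
  | mem q hq =>
    obtain ⟨x, y, rfl⟩ := hq
    refine Submodule.subset_span ⟨p.1 x, y, ?_⟩
    ext1
    · ext z
      have h : ∀ a, p.1 (C.right x a) = C.right (p.1 x) a := by
        intro a
        clear q
        induction hp using Submodule.span_induction with
        | mem p hp =>
          obtain ⟨x', y', rfl⟩ := hp
          simp only [theta_apply]
          rw [C.inner_right, C.right_mul]
        | zero => simp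
        | add p q _ _ hp hq => simp [hp, hq]
        | smul c p _ hp => simp [hp]
      simp [theta_apply, h]
    · simp only [Prod.snd_mul]
      rw [← ρ.graph_mul_ψ hp, mul_assoc]
  | zero => simp
  | add q r _ _ hq hr => rw [mul_add]; exact add_mem hq hr
  | smul c q _ hq => rw [mul_smul_comm]; exact Submodule.smul_mem _ _ hq

theorem graph_bound {p : (X →L[ℂ] X) × B} (hp : p ∈ ρ.graph) :
    ∃ K : ℝ, ∀ q ∈ ρ.graph, ‖q.2 * p.2‖ ≤ K * ‖q.1‖ := by
  induction hp using Submodule.span_induction with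
  | mem p hp =>
    obtain ⟨x, y, rfl⟩ := hp
    refine ⟨‖x‖ * ‖y‖, fun q hq => ?_⟩
    simp only
    rw [← mul_assoc, ρ.graph_mul_ψ hq]
    calc _ ≤ ‖ρ.ψ (q.1 x)‖ * ‖star (ρ.ψ y)‖ := norm_mul_le _ _
      _ ≤ (‖q.1‖ * ‖x‖) * ‖y‖ := by
        rw [norm_star]
        gcongr
        · exact (ρ.norm_ψ_le _).trans (q.1.le_opNorm x)
        · exact ρ.norm_ψ_le _
      _ = _ := by ring
  | zero => exact ⟨0, by simp⟩
  | add p q _ _ hp hq =>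
    obtain ⟨K, hK⟩ := hp
    obtain ⟨L, hL⟩ := hq
    refine ⟨K + L, fun r hr => ?_⟩
    rw [Prod.snd_add, mul_add, add_mul]
    exact (norm_add_le _ _).trans (add_le_add (hK r hr) (hL r hr))
  | smul c p _ hp =>
    obtain ⟨K, hK⟩ := hp
    refine ⟨‖c‖ * K, fun r hr => ?_⟩
    rw [Prod.smul_snd, mul_smul_comm, norm_smul, mul_assoc]
    gcongr
    exact hK r hr

theorem graph_norm_le_of_selfAdjoint {p : (X →L[ℂ] X) × B} (hp : p ∈ ρ.graph)
    (hsa : IsSelfAdjoint p.2) : ‖p.2‖ ≤ ‖p.1‖ := by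
  obtain ⟨K, hK⟩ := ρ.graph_bound hp
  have key : ∀ n : ℕ, ∃ q ∈ ρ.graph, ‖q.1‖ ≤ ‖p.1‖ ^ (n + 1) ∧
      (q.2 : Unitization ℂ B) = (p.2 : Unitization ℂ B) ^ (n + 1) := by
    intro n
    induction n with
    | zero => exact ⟨p, hp, by simp, by simp⟩
    | succ n ih =>
      obtain ⟨q, hq, h1, h2⟩ := ih
      refine ⟨q * p, ρ.graph_mul hq hp, ?_, ?_⟩
      · rw [pow_succ]
        exact (ContinuousLinearMap.opNorm_comp_le q.1 p.1).trans (by gcongr)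
      · rw [Prod.snd_mul, Unitization.inr_mul, h2, ← pow_succ]
  have hsa' : IsSelfAdjoint (p.2 : Unitization ℂ B) := by
    rw [IsSelfAdjoint, ← Unitization.inr_star, hsa.star_eq]
  have hpow : ∀ k : ℕ, ‖p.2‖ ^ 2 ^ (k + 1) ≤ |K| * ‖p.1‖ ^ (2 ^ (k + 1) - 1) := by
    intro k
    have h2 : 2 ≤ 2 ^ (k + 1) := by
      calc 2 = 2 ^ 1 := rfl
        _ ≤ 2 ^ (k + 1) := Nat.pow_le_pow_right (by norm_num) (by omega)
    obtain ⟨q, hq, h1, h3⟩ := key (2 ^ (k + 1) - 2)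
    have h4 : ((q.2 * p.2 : B) : Unitization ℂ B) = (p.2 : Unitization ℂ B) ^ 2 ^ (k + 1) := by
      rw [Unitization.inr_mul, h3, ← pow_succ]
      congr 1
      omega
    have h5 : ‖q.2 * p.2‖ = ‖p.2‖ ^ 2 ^ (k + 1) := by
      rw [← Unitization.norm_inr (𝕜 := ℂ), h4, ← Unitization.norm_inr (𝕜 := ℂ) (a := p.2)]
      have := hsa'.nnnorm_pow_two_pow (k + 1)
      simpa using congrArg NNReal.toReal this
    rw [← h5]
    refine (hK q hq).trans ?_
    have h6 : 2 ^ (k + 1) - 2 + 1 = 2 ^ (k + 1) - 1 := by omega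
    rw [h6] at h1
    exact (mul_le_mul_of_nonneg_right (le_abs_self K) (norm_nonneg _)).trans (by gcongr)
  by_contra! hlt
  have hpos : 0 < ‖p.2‖ := (norm_nonneg _).trans_lt hlt
  rcases (norm_nonneg p.1).eq_or_lt with h0 | h0
  · have := hpow 0
    rw [← h0] at this
    norm_num at this
    simp [this] at hpos
  · have hr : 1 < ‖p.2‖ / ‖p.1‖ := (one_lt_div h0).mpr hlt
    obtain ⟨n, hn⟩ := pow_unbounded_of_one_lt (|K| / ‖p.1‖) hr
    have h1 : n ≤ 2 ^ (n + 1) := (Nat.lt_two_pow_self.le).trans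
      (Nat.pow_le_pow_right (by norm_num) (by omega))
    have h2 := hn.trans_le (pow_le_pow_right₀ hr.le h1)
    have h3 := hpow n
    rw [div_pow, div_lt_div_iff₀ h0 (by positivity)] at h2
    have h4 : ‖p.1‖ ^ 2 ^ (n + 1) = ‖p.1‖ ^ (2 ^ (n + 1) - 1) * ‖p.1‖ := by
      rw [← pow_succ]
      congr 1
      have : 0 < 2 ^ (n + 1) := by positivity
      omega
    rw [h4, ← mul_assoc] at h2
    exact absurd (lt_of_mul_lt_mul_right h2 h0.le) (not_lt.mpr h3)

theorem graph_norm_le {p : (X →L[ℂ] X) × B} (hp : p ∈ ρ.graph) : ‖p.2‖ ≤ ‖p.1‖ := by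
  obtain ⟨q, hq, h1, h2⟩ := ρ.graph_star hp
  have hadj : ‖q.1‖ ≤ ‖p.1‖ := by
    refine q.1.opNorm_le_bound (norm_nonneg _) fun y => ?_
    have h : ‖q.1 y‖ * ‖q.1 y‖ ≤ (‖p.1‖ * ‖y‖) * ‖q.1 y‖ := by
      calc ‖q.1 y‖ * ‖q.1 y‖ = ‖C.inner (p.1 (q.1 y)) y‖ := by rw [h2, ← sq, C.norm_sq]
        _ ≤ ‖p.1 (q.1 y)‖ * ‖y‖ := C.norm_inner_le _ _
        _ ≤ (‖p.1‖ * ‖q.1 y‖) * ‖y‖ := by gcongr; exact p.1.le_opNorm _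
        _ = _ := by ring
    rcases (norm_nonneg (q.1 y)).eq_or_lt with h0 | h0
    · rw [← h0]; positivity
    · exact le_of_mul_le_mul_right h h0
  have h3 : ‖(q * p).2‖ ≤ ‖(q * p).1‖ := by
    refine ρ.graph_norm_le_of_selfAdjoint (ρ.graph_mul hq hp) ?_
    rw [Prod.snd_mul, h1]
    exact IsSelfAdjoint.star_mul_self _
  rw [Prod.snd_mul, h1, CStarRing.norm_star_mul_self] at h3
  have h4 : ‖(q * p).1‖ ≤ ‖p.1‖ * ‖p.1‖ :=
    (ContinuousLinearMap.opNorm_comp_le q.1 p.1).trans (by gcongr)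
  exact le_of_sq_le_sq (by nlinarith) (norm_nonneg _)

theorem fst_mem_compacts {p : (X →L[ℂ] X) × B} (hp : p ∈ ρ.graph) : p.1 ∈ C.compacts := by
  refine Submodule.le_topologicalClosure _ ?_
  induction hp using Submodule.span_induction with
  | mem p hp =>
    obtain ⟨x, y, rfl⟩ := hp
    exact Submodule.subset_span ⟨x, y, rfl⟩
  | zero => exact zero_mem _
  | add p q _ _ hp hq => exact add_mem hp hq
  | smul c p _ hp => exact Submodule.smul_mem _ _ hp

/-- First projection from the graph to the compact operators. -/
def graphFst : ρ.graph →ₗ[ℂ] C.compacts :=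
  LinearMap.codRestrict _ ((LinearMap.fst ℂ _ _).comp ρ.graph.subtype)
    fun p => ρ.fst_mem_compacts p.2

/-- Second projection from the graph. -/
def graphSnd : ρ.graph →ₗ[ℂ] B := (LinearMap.snd ℂ _ _).comp ρ.graph.subtype

/-- The map `π⁽¹⁾ : 𝒦(X) → B` induced by a representation `(π, ψ)` in `B`: the continuous linear
extension of `θ_{x,y} ↦ ψ(x) ψ(y)*`. See `induced_theta`. -/
def induced : C.compacts →L[ℂ] B := ρ.graphSnd.extendOfNorm ρ.graphFst

theorem denseRange_graphFst : DenseRange ρ.graphFst := by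
  intro T
  rw [closure_subtype]
  have h : (T : X →L[ℂ] X) ∈ closure
      (Submodule.span ℂ {T | ∃ x y, T = C.theta x y} : Set (X →L[ℂ] X)) := T.2
  refine closure_mono ?_ h
  intro S hS
  have : ∃ p ∈ ρ.graph, p.1 = S := by
    induction hS using Submodule.span_induction with
    | mem S hS =>
      obtain ⟨x, y, rfl⟩ := hS
      exact ⟨_, Submodule.subset_span ⟨x, y, rfl⟩, rfl⟩
    | zero => exact ⟨0, zero_mem _, rfl⟩
    | add S T _ _ hS hT =>
      obtain ⟨p, hp, rfl⟩ := hS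
      obtain ⟨q, hq, rfl⟩ := hT
      exact ⟨p + q, add_mem hp hq, rfl⟩
    | smul c S _ hS =>
      obtain ⟨p, hp, rfl⟩ := hS
      exact ⟨c • p, Submodule.smul_mem _ _ hp, rfl⟩
  obtain ⟨p, hp, rfl⟩ := this
  exact ⟨_, ⟨⟨p, hp⟩, rfl⟩, rfl⟩

theorem theta_mem_compacts (x y : X) : C.theta x y ∈ C.compacts :=
  Submodule.le_topologicalClosure _ (Submodule.subset_span ⟨x, y, rfl⟩)

theorem induced_theta (x y : X) :
    ρ.induced ⟨C.theta x y, theta_mem_compacts x y⟩ = ρ.ψ x * star (ρ.ψ y) :=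
  LinearMap.extendOfNorm_eq ρ.denseRange_graphFst
    ⟨1, fun p => by rw [one_mul]; exact ρ.graph_norm_le p.2⟩
    ⟨(C.theta x y, ρ.ψ x * star (ρ.ψ y)), Submodule.subset_span ⟨x, y, rfl⟩⟩

/-- A representation is (Cuntz–Pimsner) covariant if `π⁽¹⁾(φ(a)) = π(a)` whenever the left action
`φ(a)` of `a` is compact; for a correspondence with compact left action this is all `a`. -/
def Covariant : Prop :=
  ∀ (a : R) (ha : C.left a ∈ C.compacts), ρ.induced ⟨C.left a, ha⟩ = ρ.π a

end Rep

section CuntzPimsner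

variable {R X : Type u} [NonUnitalCStarAlgebra R] [NormedAddCommGroup X] [NormedSpace ℂ X]
  (C : Correspondence R X)

/-- Covariant representations of `C` in C*-algebras of the universe of `R` and `X`. -/
structure CovRep where
  B : Type u
  [inst : NonUnitalCStarAlgebra B]
  rep : C.Rep B
  covariant : rep.Covariant

attribute [instance] CovRep.inst

/-- The C*-algebra of bounded families indexed by all covariant representations. -/
abbrev CovProd : Type (u + 1) := lp (fun ρ : C.CovRep => ρ.B) ∞

/-- `a ↦ (π(a))` over all covariant representations `(π, ψ)`. -/
def prodA (a : R) : C.CovProd :=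
  ⟨fun ρ => ρ.rep.π a, memℓp_infty ⟨‖a‖, by rintro _ ⟨ρ, rfl⟩; exact ρ.rep.norm_π_le a⟩⟩

/-- `x ↦ (ψ(x))` over all covariant representations `(π, ψ)`. -/
def prodX (x : X) : C.CovProd :=
  ⟨fun ρ => ρ.rep.ψ x, memℓp_infty ⟨‖x‖, by rintro _ ⟨ρ, rfl⟩; exact ρ.rep.norm_ψ_le x⟩⟩

/-- The Cuntz–Pimsner algebra `𝒪_X` of a correspondence with compact injective left action: the
universal C*-algebra generated by the image of a covariant representation `(j_A, j_X)`. It is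
realised as the C*-algebra generated by the direct sum of all covariant representations; see
`univRep_covariant` and `existsUnique_lift` for its universal property. (No representation is missed by fixing the
universe: the C*-algebra generated by the image of a representation of `C` has a dense subset that
is the image of a set in the universe of `R` and `X`.) -/
def CuntzPimsner : Type (u + 1) :=
  cstarGen (Set.range C.prodA ∪ Set.range C.prodX)

instance : NonUnitalCStarAlgebra C.CuntzPimsner :=
  NonUnitalStarSubalgebra.nonUnitalCStarAlgebra (cstarGen (Set.range C.prodA ∪ Set.range C.prodX))

theorem CuntzPimsner.ext' {y z : C.CuntzPimsner} (h : ∀ ρ : C.CovRep, y.1 ρ = z.1 ρ) : y = z :=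
  Subtype.ext (lp.ext (funext h))

theorem prodA_mem (a : R) : C.prodA a ∈ cstarGen (Set.range C.prodA ∪ Set.range C.prodX) :=
  NonUnitalStarSubalgebra.le_topologicalClosure _
    (NonUnitalStarAlgebra.subset_adjoin ℂ _ (Or.inl ⟨a, rfl⟩))

theorem prodX_mem (x : X) : C.prodX x ∈ cstarGen (Set.range C.prodA ∪ Set.range C.prodX) :=
  NonUnitalStarSubalgebra.le_topologicalClosure _
    (NonUnitalStarAlgebra.subset_adjoin ℂ _ (Or.inr ⟨x, rfl⟩))

/-- The universal covariant representation of `C` in its Cuntz–Pimsner algebra. -/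
def univRep : C.Rep C.CuntzPimsner where
  π :=
    { toFun := fun a => ⟨C.prodA a, C.prodA_mem a⟩
      map_smul' := fun c a => by refine CuntzPimsner.ext' C fun ρ => ?_; exact map_smul ρ.rep.π c a
      map_zero' := by refine CuntzPimsner.ext' C fun ρ => ?_; exact map_zero ρ.rep.π
      map_add' := fun a b => by refine CuntzPimsner.ext' C fun ρ => ?_; exact map_add ρ.rep.π a b
      map_mul' := fun a b => by refine CuntzPimsner.ext' C fun ρ => ?_; exact map_mul ρ.rep.π a b
      map_star' := fun a => by refine CuntzPimsner.ext' C fun ρ => ?_; exact map_star ρ.rep.π a }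
  ψ :=
    { toFun := fun x => ⟨C.prodX x, C.prodX_mem x⟩
      map_add' := fun x y => by refine CuntzPimsner.ext' C fun ρ => ?_; exact map_add ρ.rep.ψ x y
      map_smul' := fun c x => by refine CuntzPimsner.ext' C fun ρ => ?_; exact map_smul ρ.rep.ψ c x }
  map_left a x := by refine CuntzPimsner.ext' C fun ρ => ?_; exact ρ.rep.map_left a x
  map_right x a := by refine CuntzPimsner.ext' C fun ρ => ?_; exact ρ.rep.map_right x a
  map_inner x y := by refine CuntzPimsner.ext' C fun ρ => ?_; exact ρ.rep.map_inner x y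

/-- The canonical map `j_A : A → 𝒪_X`. -/
def jA : R →⋆ₙₐ[ℂ] C.CuntzPimsner := C.univRep.π

/-- The canonical map `j_X : X → 𝒪_X`. -/
def jX : X →ₗ[ℂ] C.CuntzPimsner := C.univRep.ψ

/-- Coordinate projection of `𝒪_X` at a covariant representation. -/
def lift (ρ : C.CovRep) : C.CuntzPimsner →⋆ₙₐ[ℂ] ρ.B where
  toFun z := z.1 ρ
  map_smul' _ _ := rfl
  map_zero' := rfl
  map_add' _ _ := rfl
  map_mul' _ _ := rfl
  map_star' _ := rfl

theorem induced_apply_coord (ρ : C.CovRep) (T : C.compacts) :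
    C.lift ρ (C.univRep.induced T) = ρ.rep.induced T := by
  have hc : Continuous (C.lift ρ) := map_continuous _
  refine C.univRep.denseRange_graphFst.induction_on
    (p := fun T => C.lift ρ (C.univRep.induced T) = ρ.rep.induced T) T
    (isClosed_eq (hc.comp C.univRep.induced.continuous) ρ.rep.induced.continuous) ?_
  rintro ⟨p, hp⟩
  have : ∀ h, C.lift ρ (C.univRep.induced ⟨p.1, h⟩) = ρ.rep.induced ⟨p.1, h⟩ := by
    induction hp using Submodule.span_induction with
    | mem p hp =>
      obtain ⟨x, y, rfl⟩ := hp
      intro h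
      rw [Rep.induced_theta, Rep.induced_theta]
      rfl
    | zero =>
      intro h
      have : (⟨(0 : (X →L[ℂ] X) × C.CuntzPimsner).1, h⟩ : C.compacts) = 0 := rfl
      rw [this, map_zero, map_zero, map_zero]
    | add p q hp hq ihp ihq =>
      intro h
      have hp' := C.univRep.fst_mem_compacts hp
      have hq' := C.univRep.fst_mem_compacts hq
      have : (⟨(p + q).1, h⟩ : C.compacts) = ⟨p.1, hp'⟩ + ⟨q.1, hq'⟩ := rfl
      rw [this, map_add, map_add, map_add, ihp, ihq]
    | smul c p hp ih =>
      intro h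
      have hp' := C.univRep.fst_mem_compacts hp
      have : (⟨(c • p).1, h⟩ : C.compacts) = c • ⟨p.1, hp'⟩ := rfl
      rw [this, map_smul, map_smul, map_smul, ih]
  exact this _

theorem univRep_covariant : C.univRep.Covariant := by
  intro a ha
  refine CuntzPimsner.ext' C fun ρ => ?_
  exact (C.induced_apply_coord ρ _).trans (ρ.covariant a ha)

/-- A closed-set induction on the Cuntz–Pimsner algebra. -/
theorem CuntzPimsner.induction_on' {P : C.CuntzPimsner → Prop} (hP : IsClosed {z | P z})
    (hA : ∀ a, P (C.jA a)) (hX : ∀ x, P (C.jX x)) (hadd : ∀ y z, P y → P z → P (y + z))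
    (hmul : ∀ y z, P y → P z → P (y * z)) (hsmul : ∀ (c : ℂ) y, P y → P (c • y))
    (hstar : ∀ y, P y → P (star y)) (z : C.CuntzPimsner) : P z := by
  have hle := NonUnitalStarSubalgebra.le_topologicalClosure
    (NonUnitalStarAlgebra.adjoin ℂ (Set.range C.prodA ∪ Set.range C.prodX))
  have hmem : ∀ w (hw : w ∈ NonUnitalStarAlgebra.adjoin ℂ (Set.range C.prodA ∪ Set.range C.prodX)),
      P (⟨w, hle hw⟩ : cstarGen (Set.range C.prodA ∪ Set.range C.prodX)) := by
    intro w hw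
    induction hw using NonUnitalStarAlgebra.adjoin_induction with
    | mem w hw =>
      rcases hw with ⟨a, rfl⟩ | ⟨x, rfl⟩
      · exact hA a
      · exact hX x
    | zero =>
      have := hsmul 0 (C.jX 0) (hX 0)
      rwa [zero_smul] at this
    | add y z hy hz ihy ihz => exact hadd _ _ ihy ihz
    | mul y z hy hz ihy ihz => exact hmul _ _ ihy ihz
    | smul c y hy ih => exact hsmul c _ ih
    | star y hy ih => exact hstar _ ih
  have hz : ∀ z : cstarGen (Set.range C.prodA ∪ Set.range C.prodX),
      z ∈ closure {w : cstarGen (Set.range C.prodA ∪ Set.range C.prodX) |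
        (w : C.CovProd) ∈ NonUnitalStarAlgebra.adjoin ℂ
          (Set.range C.prodA ∪ Set.range C.prodX)} := by
    intro z
    rw [closure_subtype]
    refine closure_mono ?_ z.2
    intro w hw
    exact ⟨⟨w, hle hw⟩, hw, rfl⟩
  exact closure_minimal (fun w hw => hmem w.1 hw) hP (hz z)

/-- The universal property of the Cuntz–Pimsner algebra. -/
theorem existsUnique_lift {B : Type u} [NonUnitalCStarAlgebra B] (ρ : C.Rep B)
    (hρ : ρ.Covariant) : ∃! Θ : C.CuntzPimsner →⋆ₙₐ[ℂ] B,
      (∀ a, Θ (C.jA a) = ρ.π a) ∧ ∀ x, Θ (C.jX x) = ρ.ψ x := by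
  refine ⟨C.lift ⟨B, ρ, hρ⟩, ⟨fun _ => rfl, fun _ => rfl⟩, ?_⟩
  rintro Θ ⟨h1, h2⟩
  refine DFunLike.ext _ _ fun z => ?_
  refine CuntzPimsner.induction_on' C (P := fun z => Θ z = C.lift ⟨B, ρ, hρ⟩ z)
    (isClosed_eq (map_continuous Θ) (map_continuous (C.lift ⟨B, ρ, hρ⟩))) h1 h2
    ?_ ?_ ?_ ?_ z
  · intro y z hy hz
    simp only [map_add, hy, hz]
  · intro y z hy hz
    simp only [map_mul, hy, hz]
  · intro c y hy
    simp only [map_smul, hy]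
  · intro y hy
    simp only [map_star, hy]

end CuntzPimsner

end Correspondence

end

noncomputable section

/-! ### Generalities on C*-algebras -/

/-! Write R for the coefficient algebra. The inclusions of R and X in A form a covariant
representation, so the universal property gives Θ : 𝒪_X → A, and the required isomorphism is Θ⁻¹.

Covariance: the approximate identity puts R inside clsp XX* (`subset_clspMul_star`). Hence R acts on
X by compact operators. An element d of clsp XX* with dX = 0 satisfies dd* = 0. Both injectivity of
the left action and covariance (`inclusion_covariant`) follow from this.

Injectivity of Θ is a graded uniqueness argument (`isometry_of_isCStarGrading`) that uses only the
expectation E on A, with no gauge action on 𝒪_X. Let P_k be the closed span of X^k R in 𝒪_X. A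
degree-zero combination of words preserves P_k for all large k. By covariance and nondegeneracy 𝒪_X
acts faithfully on P_k, and P_k* P_k lies in P_0, where Θ is isometric; so Θ is isometric in degree
zero. Applying E to products in A recovers homogeneous components and gives ‖b‖ ≤ (2N+1)‖Θ b‖ for b
of degree at most N. Passing to high powers through the C*-identity removes the factor
(`norm_le_of_mem_iSup`).

Surjectivity: a strongly graded algebra is generated by A_1, which lies in C*(X). The equality A =
C*(X) also gives uniqueness. -/

theorem mul_mem_clspMul {A : Type*} [NonUnitalCStarAlgebra A] {S T : Set A} {s t : A}
    (hs : s ∈ S) (ht : t ∈ T) : s * t ∈ clspMul S T :=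
  Submodule.le_topologicalClosure _ (Submodule.subset_span ⟨s, hs, t, ht, rfl⟩)

theorem clspMul_le {A : Type*} [NonUnitalCStarAlgebra A] {S T : Set A} {P : Submodule ℂ A}
    (hP : IsClosed (P : Set A)) (h : ∀ s ∈ S, ∀ t ∈ T, s * t ∈ P) : clspMul S T ≤ P := by
  refine Submodule.topologicalClosure_minimal _ (Submodule.span_le.mpr ?_) hP
  rintro _ ⟨s, hs, t, ht, rfl⟩
  exact h s hs t ht

theorem isClosed_clspMul {A : Type*} [NonUnitalCStarAlgebra A] (S T : Set A) :
    IsClosed (clspMul S T : Set A) :=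
  Submodule.isClosed_topologicalClosure _

/-- The elements mapped into `Q` by left multiplication by `b`. -/
def mulLeftComap {A : Type*} [NonUnitalCStarAlgebra A] (b : A) (Q : Submodule ℂ A) :
    Submodule ℂ A := Q.comap (LinearMap.mulLeft ℂ b)

theorem isClosed_mulLeftComap {A : Type*} [NonUnitalCStarAlgebra A] (b : A)
    {Q : Submodule ℂ A} (hQ : IsClosed (Q : Set A)) :
    IsClosed (mulLeftComap b Q : Set A) :=
  hQ.preimage (continuous_const_mul b)

theorem mul_mem_of_mem_clspMul {A : Type*} [NonUnitalCStarAlgebra A] {S T : Set A} (b : A)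
    {Q : Submodule ℂ A} (hQ : IsClosed (Q : Set A)) (h : ∀ s ∈ S, ∀ t ∈ T, b * (s * t) ∈ Q)
    {c : A} (hc : c ∈ clspMul S T) : b * c ∈ Q :=
  clspMul_le (P := mulLeftComap b Q) (isClosed_mulLeftComap b hQ) h hc

/-- Typically applied with c = b*, where it gives bb* = 0 and hence b = 0. -/
theorem mul_eq_zero_of_mem_clspMul {A : Type*} [NonUnitalCStarAlgebra A] {S T : Set A} {b : A}
    (h : ∀ s ∈ S, b * s = 0) {c : A} (hc : c ∈ clspMul S T) : b * c = 0 := by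
  have := mul_mem_of_mem_clspMul (Q := ⊥) b (by simp)
    (fun s hs t _ => by rw [Submodule.mem_bot, ← mul_assoc, h s hs, zero_mul]) hc
  simpa using this

/-! ### Star homomorphisms out of densely graded C*-algebras -/

section graded

variable {A : Type*} {B : Type*} [NonUnitalCStarAlgebra A] [NonUnitalCStarAlgebra B]

/-- The sum of the graded subspaces of degrees between `-N` and `N`. -/
def degreeLE (H : ℤ → Submodule ℂ B) (N : ℕ) : Submodule ℂ B :=
  ⨆ n ∈ Finset.Icc (-N : ℤ) N, H n

variable {H : ℤ → Submodule ℂ B}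

theorem le_degreeLE {n : ℤ} {N : ℕ} (h : n.natAbs ≤ N) : H n ≤ degreeLE H N :=
  le_iSup₂_of_le (f := fun n (_ : n ∈ Finset.Icc (-N : ℤ) N) => H n) n
    (by rw [Finset.mem_Icc]; omega) le_rfl

theorem degreeLE_le {N : ℕ} {P : Submodule ℂ B} (h : ∀ n : ℤ, n.natAbs ≤ N → H n ≤ P) :
    degreeLE H N ≤ P :=
  iSup₂_le fun n hn => h n (by rw [Finset.mem_Icc] at hn; omega)

theorem degreeLE_mono {M N : ℕ} (h : M ≤ N) : degreeLE H M ≤ degreeLE H N :=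
  degreeLE_le fun _ hn => le_degreeLE (hn.trans h)

theorem mul_mem_degreeLE (hmul : ∀ m n, ∀ b ∈ H m, ∀ c ∈ H n, b * c ∈ H (m + n))
    {M N : ℕ} {b c : B} (hb : b ∈ degreeLE H M) (hc : c ∈ degreeLE H N) :
    b * c ∈ degreeLE H (M + N) := by
  have h1 : ∀ m : ℤ, m.natAbs ≤ M → ∀ b ∈ H m, b * c ∈ degreeLE H (M + N) := by
    intro m hm b hb
    exact degreeLE_le (P := (degreeLE H (M + N)).comap (LinearMap.mulLeft ℂ b))
      (fun n hn d hd => le_degreeLE (by omega) (hmul m n b hb d hd)) hc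
  exact degreeLE_le (P := (degreeLE H (M + N)).comap (LinearMap.mulRight ℂ c))
    (fun m hm b hb => h1 m hm b hb) hb

theorem star_mem_degreeLE (hstar : ∀ n, ∀ b ∈ H n, star b ∈ H (-n)) {N : ℕ} {b : B}
    (hb : b ∈ degreeLE H N) : star b ∈ degreeLE H N := by
  refine degreeLE_le (P := (degreeLE H N).comap (starLinearEquiv ℂ (A := B)).toLinearMap) ?_ hb
  intro n hn b hb
  exact le_degreeLE (by simpa using hn) (hstar n b hb)

theorem exists_mem_degreeLE {b : B} (hb : b ∈ ⨆ n, H n) : ∃ N, b ∈ degreeLE H N := by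
  induction hb using Submodule.iSup_induction' with
  | mem n b hb => exact ⟨n.natAbs, le_degreeLE le_rfl hb⟩
  | zero => exact ⟨0, zero_mem _⟩
  | add b c _ _ hb hc =>
    obtain ⟨M, hM⟩ := hb
    obtain ⟨N, hN⟩ := hc
    exact ⟨max M N, add_mem (degreeLE_mono (le_max_left _ _) hM)
      (degreeLE_mono (le_max_right _ _) hN)⟩

/-- The star subalgebra spanned by the graded subspaces. -/
def gradedStarSubalgebra (H : ℤ → Submodule ℂ B)
    (hmul : ∀ m n, ∀ b ∈ H m, ∀ c ∈ H n, b * c ∈ H (m + n))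
    (hstar : ∀ n, ∀ b ∈ H n, star b ∈ H (-n)) : NonUnitalStarSubalgebra ℂ B :=
  { (⨆ n, H n : Submodule ℂ B) with
    mul_mem' := by
      intro b c hb hc
      obtain ⟨M, hM⟩ := exists_mem_degreeLE hb
      obtain ⟨N, hN⟩ := exists_mem_degreeLE hc
      exact degreeLE_le (fun n _ => le_iSup H n) (mul_mem_degreeLE hmul hM hN)
    star_mem' := by
      intro b hb
      obtain ⟨N, hN⟩ := exists_mem_degreeLE hb
      exact degreeLE_le (fun n _ => le_iSup H n) (star_mem_degreeLE hstar hN) }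

variable (hmul : ∀ m n, ∀ b ∈ H m, ∀ c ∈ H n, b * c ∈ H (m + n))
  (hstar : ∀ n, ∀ b ∈ H n, star b ∈ H (-n))
  (Θ : B →⋆ₙₐ[ℂ] A) (h0 : ∀ b ∈ H 0, ‖Θ b‖ = ‖b‖)
  (E : A →ₗ[ℂ] A) (hE : ∀ a, ‖E a‖ ≤ ‖a‖) (hE0 : ∀ b ∈ H 0, E (Θ b) = Θ b)
  (hEn : ∀ n, n ≠ 0 → ∀ b ∈ H n, E (Θ b) = 0)

include hmul hstar h0 hE hE0 hEn

/-- A Fourier coefficient estimate: compressing Θ(f n)* Θ(b) by E isolates the degree-n component,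
so each component has norm at most ‖Θ b‖, and there are 2N+1 of them. The decomposition of b is
arbitrary; independence of the subspaces is not needed. -/
theorem norm_le_of_mem_degreeLE {N : ℕ} {b : B} (hb : b ∈ degreeLE H N) :
    ‖b‖ ≤ (2 * N + 1) * ‖Θ b‖ := by
  obtain ⟨f, rfl⟩ := (Submodule.mem_iSup_finset_iff_exists_sum _ _).mp hb
  set s := Finset.Icc (-N : ℤ) N with hs
  set b := ∑ i ∈ s, (f i : B)
  -- The C*-identity transfers isometry from degree zero, where (f n)* (f n) lives, to degree n.
  have hiso : ∀ n, ‖Θ (f n)‖ = ‖(f n : B)‖ := by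
    intro n
    have h1 : star (f n : B) * f n ∈ H 0 := by
      simpa using hmul (-n) n _ (hstar n _ (f n).2) _ (f n).2
    have h2 := h0 _ h1
    rw [map_mul, map_star, CStarRing.norm_star_mul_self, CStarRing.norm_star_mul_self] at h2
    exact (mul_self_inj (norm_nonneg _) (norm_nonneg _)).mp h2
  have hcomp : ∀ n ∈ s, ‖(f n : B)‖ ≤ ‖Θ b‖ := by
    intro n hn
    -- The cross terms have degree m - n ≠ 0 and are killed by E.
    have h1 : E (star (Θ (f n)) * Θ b) = star (Θ (f n)) * Θ (f n) := by
      simp only [b, map_sum, Finset.mul_sum, ← map_star, ← map_mul]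
      rw [Finset.sum_eq_single n]
      · exact hE0 _ (by simpa using hmul (-n) n _ (hstar n _ (f n).2) _ (f n).2)
      · intro m _ hm
        exact hEn (-n + m) (by omega) _ (hmul _ _ _ (hstar n _ (f n).2) _ (f m).2)
      · exact fun h => absurd hn h
    have h2 := hE (star (Θ (f n)) * Θ b)
    rw [h1, CStarRing.norm_star_mul_self] at h2
    have h3 := h2.trans (norm_mul_le _ _)
    rw [norm_star] at h3
    rw [← hiso n]
    rcases (norm_nonneg (Θ (f n))).eq_or_lt with h | h
    · rw [← h]; exact norm_nonneg _
    · exact le_of_mul_le_mul_left h3 h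
  calc ‖b‖ ≤ ∑ i ∈ s, ‖(f i : B)‖ := norm_sum_le _ _
    _ ≤ ∑ _i ∈ s, ‖Θ b‖ := Finset.sum_le_sum hcomp
    _ = (2 * N + 1) * ‖Θ b‖ := by
      rw [Finset.sum_const, nsmul_eq_mul, hs, Int.card_Icc]
      congr 1
      have : ((N : ℤ) + 1 - -N).toNat = 2 * N + 1 := by omega
      rw [this]
      push_cast
      ring

/-- Iterating c ↦ c* c raises both norms to the power 2^k but only multiplies the degree bound by
2^k. The constant 2N+1 thus grows linearly in 2^k, whereas a ratio ‖b‖/‖Θ b‖ > 1 would grow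
exponentially in 2^k. -/
theorem norm_le_of_mem_iSup {b : B} (hb : b ∈ ⨆ n, H n) : ‖b‖ ≤ ‖Θ b‖ := by
  obtain ⟨N, hN⟩ := exists_mem_degreeLE hb
  have hpow : ∀ k : ℕ, ∃ c ∈ degreeLE H (2 ^ k * N),
      ‖c‖ = ‖b‖ ^ 2 ^ k ∧ ‖Θ c‖ = ‖Θ b‖ ^ 2 ^ k := by
    intro k
    induction k with
    | zero => exact ⟨b, by simpa using hN, by simp, by simp⟩
    | succ k ih =>
      obtain ⟨c, hc, h1, h2⟩ := ih
      refine ⟨star c * c, ?_, ?_, ?_⟩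
      · have := mul_mem_degreeLE hmul (star_mem_degreeLE hstar hc) hc
        rwa [← two_mul, ← mul_assoc, ← pow_succ'] at this
      · rw [CStarRing.norm_star_mul_self, h1, ← pow_add, ← two_mul, ← pow_succ']
      · rw [map_mul, map_star, CStarRing.norm_star_mul_self, h2, ← pow_add, ← two_mul,
          ← pow_succ']
  have hbound : ∀ k : ℕ, ‖b‖ ^ 2 ^ k ≤ (2 * (2 ^ k * N) + 1) * ‖Θ b‖ ^ 2 ^ k := by
    intro k
    obtain ⟨c, hc, h1, h2⟩ := hpow k
    have := norm_le_of_mem_degreeLE hmul hstar Θ h0 E hE hE0 hEn hc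
    rw [h1, h2] at this
    exact_mod_cast this
  by_contra! hlt
  -- If Θ b = 0 the ratio is unavailable, but the bound at k = 0 already forces b = 0.
  rcases (norm_nonneg (Θ b)).eq_or_lt with h | h
  · have := hbound 0
    rw [← h] at this hlt
    norm_num at this
    simp [this] at hlt
  · set r := ‖b‖ / ‖Θ b‖ with hr
    have hr1 : 1 < r := (one_lt_div h).mpr hlt
    have hb' : ∀ k : ℕ, r ^ 2 ^ k ≤ (2 * N + 1) * ((2 ^ k : ℕ) : ℝ) := by
      intro k
      have h1 : r ^ 2 ^ k ≤ 2 * (2 ^ k * N) + 1 := by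
        rw [hr, div_pow, div_le_iff₀ (by positivity)]
        exact hbound k
      have h2 : (1 : ℝ) ≤ 2 ^ k := one_le_pow₀ (by norm_num)
      push_cast
      linarith
    have hlim : Tendsto (fun k : ℕ => ((2 ^ k : ℕ) : ℝ) / r ^ 2 ^ k) atTop (𝓝 0) := by
      have := tendsto_pow_const_div_const_pow_of_one_lt 1 hr1
      simp only [pow_one] at this
      exact this.comp (tendsto_pow_atTop_atTop_of_one_lt (by norm_num))
    have hpos : (0 : ℝ) < 1 / (2 * N + 1) := by positivity
    obtain ⟨k, hk⟩ := (hlim.eventually (gt_mem_nhds hpos)).exists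
    rw [div_lt_div_iff₀ (by positivity) (by positivity)] at hk
    have := hb' k
    linarith

/-- A star homomorphism out of a C*-algebra with a dense `ℤ`-graded subalgebra is isometric as soon
as it is isometric in degree zero and its range carries a contraction onto degree zero. -/
theorem isometry_of_isometry_degree_zero (hdense : (⨆ n, H n).topologicalClosure = ⊤) :
    Isometry Θ := by
  refine NonUnitalStarAlgHom.isometry Θ ?_
  rw [injective_iff_map_eq_zero]
  intro b hb
  -- The inequality is a closed condition, so it passes from the dense graded subalgebra to all of
  -- B. This is why a norm bound, and not mere injectivity, was proved there.
  have hcl : IsClosed {c : B | ‖c‖ ≤ ‖Θ c‖} :=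
    isClosed_le continuous_norm (map_continuous Θ).norm
  have hmem : b ∈ closure ((⨆ n, H n : Submodule ℂ B) : Set B) := by
    rw [← Submodule.topologicalClosure_coe, hdense]
    trivial
  have : ‖b‖ ≤ ‖Θ b‖ := closure_minimal (fun c hc =>
    norm_le_of_mem_iSup hmul hstar Θ h0 E hE hE0 hEn hc) hcl hmem
  simpa [hb] using this

end graded

/-! ### The graded uniqueness theorem for Cuntz–Pimsner algebras -/

namespace Correspondence

namespace Rep

variable {R X : Type*} [NonUnitalCStarAlgebra R] [NormedAddCommGroup X] [NormedSpace ℂ X]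
  {C : Correspondence R X} {B : Type v} [NonUnitalCStarAlgebra B] (ρ : C.Rep B)

theorem induced_graphFst (p : ρ.graph) : ρ.induced (ρ.graphFst p) = p.1.2 :=
  LinearMap.extendOfNorm_eq ρ.denseRange_graphFst
    ⟨1, fun p => by rw [one_mul]; exact ρ.graph_norm_le p.2⟩ p

/-- Both sides are continuous in T and agree on finite-rank operators. Together with
`induced_mem_clspMul` this pins down π⁽¹⁾(T), since elements of clsp ψ(X)ψ(X)* are determined by
left multiplication on ψ(X). -/
theorem induced_mul_ψ (T : C.compacts) (z : X) :
    ρ.induced T * ρ.ψ z = ρ.ψ ((T : X →L[ℂ] X) z) := by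
  have hψ : Continuous ρ.ψ :=
    (ρ.ψ.mkContinuous 1 fun x => by rw [one_mul]; exact ρ.norm_ψ_le x).continuous
  refine ρ.denseRange_graphFst.induction_on
    (p := fun T => ρ.induced T * ρ.ψ z = ρ.ψ ((T : X →L[ℂ] X) z)) T (isClosed_eq ?_ ?_) ?_
  · exact ρ.induced.continuous.mul continuous_const
  · exact hψ.comp ((ContinuousLinearMap.apply ℂ X z).continuous.comp continuous_subtype_val)
  · intro p
    rw [induced_graphFst]
    exact ρ.graph_mul_ψ p.2 z

theorem induced_mem_clspMul (T : C.compacts) :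
    ρ.induced T ∈ clspMul (Set.range ρ.ψ) (star (Set.range ρ.ψ)) := by
  refine ρ.denseRange_graphFst.induction_on
    (p := fun T => ρ.induced T ∈ clspMul (Set.range ρ.ψ) (star (Set.range ρ.ψ))) T
    ((isClosed_clspMul _ _).preimage ρ.induced.continuous) ?_
  rintro ⟨p, hp⟩
  rw [induced_graphFst]
  refine Submodule.span_le (p := (clspMul (Set.range ρ.ψ) (star (Set.range ρ.ψ))).comap
    (LinearMap.snd ℂ (X →L[ℂ] X) B)).mpr ?_ hp
  rintro _ ⟨x, y, rfl⟩
  exact mul_mem_clspMul ⟨x, rfl⟩ ⟨y, by simp⟩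

end Rep

/-! ### Degrees of words and the modules P_k in the Cuntz–Pimsner algebra -/

section uniqueness

variable {R X : Type u} [NonUnitalCStarAlgebra R] [NormedAddCommGroup X] [NormedSpace ℂ X]
  (C : Correspondence R X)

/-- Products of elements of `j_A(R)`, `j_X(X)`, `j_X(X)*`, with their degree. -/
inductive IsWord : ℤ → C.CuntzPimsner → Prop
  | jA (a : R) : IsWord 0 (C.jA a)
  | jX (x : X) : IsWord 1 (C.jX x)
  | star_jX (x : X) : IsWord (-1) (star (C.jX x))
  | mul (m n : ℤ) (v w : C.CuntzPimsner) : IsWord m v → IsWord n w → IsWord (m + n) (v * w)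

theorem IsWord.star {n : ℤ} {w : C.CuntzPimsner} (h : C.IsWord n w) :
    C.IsWord (-n) (star w) := by
  induction h with
  | jA a => rw [← map_star]; exact .jA _
  | jX x => exact .star_jX x
  | star_jX x => rw [star_star, neg_neg]; exact .jX x
  | mul m n v w _ _ hv hw =>
    rw [star_mul, neg_add_rev]
    exact .mul _ _ _ _ hw hv

/-- The linear span of the words of degree `n`. -/
def wordSpan (n : ℤ) : Submodule ℂ C.CuntzPimsner := Submodule.span ℂ {w | C.IsWord n w}

theorem mul_mem_wordSpan (m n : ℤ) (b : C.CuntzPimsner) (hb : b ∈ C.wordSpan m)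
    (c : C.CuntzPimsner) (hc : c ∈ C.wordSpan n) : b * c ∈ C.wordSpan (m + n) := by
  have h : ∀ b, C.IsWord m b → b * c ∈ C.wordSpan (m + n) := fun b hb =>
    Submodule.span_le (p := (C.wordSpan (m + n)).comap (LinearMap.mulLeft ℂ b)) |>.mpr
      (fun d hd => Submodule.subset_span (.mul _ _ _ _ hb hd)) hc
  exact Submodule.span_le (p := (C.wordSpan (m + n)).comap (LinearMap.mulRight ℂ c)) |>.mpr h hb

theorem star_mem_wordSpan (n : ℤ) (b : C.CuntzPimsner) (hb : b ∈ C.wordSpan n) :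
    star b ∈ C.wordSpan (-n) :=
  Submodule.span_le (p := (C.wordSpan (-n)).comap
    (starLinearEquiv ℂ (A := C.CuntzPimsner)).toLinearMap) |>.mpr
    (fun _ hd => Submodule.subset_span hd.star) hb

/-- The closure of the span of all words is a closed star subalgebra containing the generators. -/
theorem dense_wordSpan : (⨆ n, C.wordSpan n).topologicalClosure = ⊤ := by
  set S := gradedStarSubalgebra C.wordSpan C.mul_mem_wordSpan C.star_mem_wordSpan
  have hS : ∀ n w, C.IsWord n w → w ∈ S.topologicalClosure := fun n w hw =>
    S.le_topologicalClosure (le_iSup C.wordSpan n (Submodule.subset_span hw))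
  rw [eq_top_iff]
  intro z _
  change z ∈ S.topologicalClosure
  exact CuntzPimsner.induction_on' C (P := fun z => z ∈ S.topologicalClosure)
    S.isClosed_topologicalClosure (fun a => hS _ _ (.jA a)) (fun x => hS _ _ (.jX x))
    (fun _ _ => add_mem) (fun _ _ => mul_mem) (fun c _ h => SMulMemClass.smul_mem c h)
    (fun _ => star_mem) z

/-- The closed linear span of the products `j_X(x₁) ⋯ j_X(xₖ) j_A(a)`. -/
def powerSpan : ℕ → Submodule ℂ C.CuntzPimsner
  | 0 => (LinearMap.range (C.jA : R →ₗ[ℂ] C.CuntzPimsner)).topologicalClosure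
  | k + 1 => clspMul (Set.range C.jX) (powerSpan k)

theorem isClosed_powerSpan (k : ℕ) : IsClosed (C.powerSpan k : Set C.CuntzPimsner) := by
  cases k <;> exact Submodule.isClosed_topologicalClosure _

theorem jX_mul_mem_powerSpan (x : X) {k : ℕ} {v : C.CuntzPimsner} (hv : v ∈ C.powerSpan k) :
    C.jX x * v ∈ C.powerSpan (k + 1) :=
  mul_mem_clspMul ⟨x, rfl⟩ hv

theorem jA_mem_powerSpan_zero (a : R) : C.jA a ∈ C.powerSpan 0 :=
  Submodule.le_topologicalClosure _ ⟨a, rfl⟩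

theorem powerSpan_zero_le {Q : Submodule ℂ C.CuntzPimsner}
    (hQ : IsClosed (Q : Set C.CuntzPimsner)) (h : ∀ a, C.jA a ∈ Q) : C.powerSpan 0 ≤ Q := by
  refine Submodule.topologicalClosure_minimal _ ?_ hQ
  rintro _ ⟨a, rfl⟩
  exact h a

theorem jA_mul_mem_powerSpan (a : R) {k : ℕ} {v : C.CuntzPimsner} (hv : v ∈ C.powerSpan k) :
    C.jA a * v ∈ C.powerSpan k := by
  cases k with
  | zero =>
    refine C.powerSpan_zero_le (Q := mulLeftComap (C.jA a) (C.powerSpan 0))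
      (isClosed_mulLeftComap _ (C.isClosed_powerSpan 0)) (fun b => ?_) hv
    change C.jA a * C.jA b ∈ C.powerSpan 0
    rw [← map_mul]
    exact C.jA_mem_powerSpan_zero _
  | succ k =>
    refine mul_mem_of_mem_clspMul _ (C.isClosed_powerSpan _) ?_ hv
    rintro _ ⟨x, rfl⟩ w hw
    rw [← mul_assoc]
    have : C.jA a * C.jX x = C.jX (C.left a x) := (C.univRep.map_left a x).symm
    rw [this]
    exact C.jX_mul_mem_powerSpan _ hw

theorem star_jX_mul_jX (x y : X) : star (C.jX x) * C.jX y = C.jA (C.inner x y) :=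
  (C.univRep.map_inner x y).symm

theorem star_jX_mul_mem_powerSpan (x : X) {k : ℕ} {v : C.CuntzPimsner}
    (hv : v ∈ C.powerSpan (k + 1)) : star (C.jX x) * v ∈ C.powerSpan k := by
  refine mul_mem_of_mem_clspMul _ (C.isClosed_powerSpan _) ?_ hv
  rintro _ ⟨y, rfl⟩ w hw
  rw [← mul_assoc, star_jX_mul_jX]
  exact C.jA_mul_mem_powerSpan _ hw

/-- A word of degree n shifts P_k to P_{k+n}, provided k is large enough that no intermediate
product needs a negative index: `star (C.jX x)` can only be applied to P_k with k ≥ 1. The bound 0 ≤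
k₀ + n makes the target index a natural number. -/
theorem IsWord.exists_mul_mem_powerSpan {n : ℤ} {w : C.CuntzPimsner} (h : C.IsWord n w) :
    ∃ k₀ : ℕ, 0 ≤ k₀ + n ∧ ∀ k l : ℕ, k₀ ≤ k → (l : ℤ) = k + n →
      ∀ v ∈ C.powerSpan k, w * v ∈ C.powerSpan l := by
  induction h with
  | jA a =>
    refine ⟨0, by simp, fun k l _ hl v hv => ?_⟩
    obtain rfl : l = k := by omega
    exact C.jA_mul_mem_powerSpan a hv
  | jX x =>
    refine ⟨0, by simp, fun k l _ hl v hv => ?_⟩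
    obtain rfl : l = k + 1 := by omega
    exact C.jX_mul_mem_powerSpan x hv
  | star_jX x =>
    refine ⟨1, by simp, fun k l _ hl v hv => ?_⟩
    obtain rfl : k = l + 1 := by omega
    exact C.star_jX_mul_mem_powerSpan x hv
  | mul m n u w _ _ hu hw =>
    obtain ⟨k₁, h1, hu⟩ := hu
    obtain ⟨k₂, h2, hw⟩ := hw
    -- The right factor w acts first and needs k ≥ k₂; then u acts at index k + n, which must be at
    -- least k₁.
    refine ⟨max k₂ (k₁ - n).toNat, by omega, fun k l hk hl v hv => ?_⟩
    rw [mul_assoc]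
    obtain ⟨k', hk'⟩ : ∃ k' : ℕ, (k' : ℤ) = k + n := ⟨(k + n).toNat, by omega⟩
    exact hu k' l (by omega) (by omega) _ (hw k k' (by omega) hk' v hv)

theorem exists_mul_mem_powerSpan {b : C.CuntzPimsner} (hb : b ∈ C.wordSpan 0) :
    ∃ k₀ : ℕ, ∀ k, k₀ ≤ k → ∀ v ∈ C.powerSpan k, b * v ∈ C.powerSpan k := by
  induction hb using Submodule.span_induction with
  | mem w hw =>
    obtain ⟨k₀, _, h⟩ := hw.exists_mul_mem_powerSpan
    exact ⟨k₀, fun k hk v hv => h k k hk (by simp) v hv⟩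
  | zero => exact ⟨0, fun k _ v _ => by simp⟩
  | add b c _ _ hb hc =>
    obtain ⟨k₁, h1⟩ := hb
    obtain ⟨k₂, h2⟩ := hc
    refine ⟨max k₁ k₂, fun k hk v hv => ?_⟩
    rw [add_mul]
    exact add_mem (h1 k (by omega) v hv) (h2 k (by omega) v hv)
  | smul c b _ hb =>
    obtain ⟨k₀, h⟩ := hb
    refine ⟨k₀, fun k hk v hv => ?_⟩
    rw [smul_mul_assoc]
    exact Submodule.smul_mem _ _ (h k hk v hv)

/-- The elements that, together with their adjoints, leave `C.powerSpan k` invariant. -/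
def powerStabilizer (k : ℕ) : NonUnitalStarSubalgebra ℂ C.CuntzPimsner where
  carrier := {b | (∀ v ∈ C.powerSpan k, b * v ∈ C.powerSpan k) ∧
    ∀ v ∈ C.powerSpan k, star b * v ∈ C.powerSpan k}
  add_mem' := by
    rintro b c ⟨h1, h2⟩ ⟨h3, h4⟩
    refine ⟨fun v hv => ?_, fun v hv => ?_⟩
    · rw [add_mul]; exact add_mem (h1 v hv) (h3 v hv)
    · rw [star_add, add_mul]; exact add_mem (h2 v hv) (h4 v hv)
  zero_mem' := by simp
  mul_mem' := by
    rintro b c ⟨h1, h2⟩ ⟨h3, h4⟩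
    refine ⟨fun v hv => ?_, fun v hv => ?_⟩
    · rw [mul_assoc]; exact h1 _ (h3 v hv)
    · rw [star_mul, mul_assoc]; exact h4 _ (h2 v hv)
  smul_mem' := by
    rintro z b ⟨h1, h2⟩
    refine ⟨fun v hv => ?_, fun v hv => ?_⟩
    · rw [smul_mul_assoc]; exact Submodule.smul_mem _ _ (h1 v hv)
    · rw [star_smul, smul_mul_assoc]; exact Submodule.smul_mem _ _ (h2 v hv)
  star_mem' := by
    rintro b ⟨h1, h2⟩
    exact ⟨h2, by simpa using h1⟩

/-- Closedness makes the stabilizer a C*-algebra, on which injective star homomorphisms are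
isometric. -/
instance isClosed_powerStabilizer (k : ℕ) :
    IsClosed (C.powerStabilizer k : Set C.CuntzPimsner) := by
  have h : (C.powerStabilizer k : Set C.CuntzPimsner) =
      (⋂ v ∈ C.powerSpan k, {b | b * v ∈ C.powerSpan k}) ∩
        ⋂ v ∈ C.powerSpan k, {b | star b * v ∈ C.powerSpan k} := by
    ext b
    simp only [Set.mem_inter_iff, Set.mem_iInter₂]
    rfl
  rw [h]
  refine IsClosed.inter ?_ ?_ <;> refine isClosed_biInter fun v _ => ?_
  · exact (C.isClosed_powerSpan k).preimage (continuous_mul_const v)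
  · exact (C.isClosed_powerSpan k).preimage ((continuous_mul_const v).comp continuous_star)

/-- This makes v* w a P_0-valued inner product on P_k. The induction rests on (xu)* w = u* (x* w),
with x* w one level lower. -/
theorem star_mul_mem_powerSpan_zero {k : ℕ} : ∀ {v w : C.CuntzPimsner}, v ∈ C.powerSpan k →
    w ∈ C.powerSpan k → star v * w ∈ C.powerSpan 0 := by
  induction k with
  | zero =>
    intro v w hv hw
    have hstar : star v ∈ C.powerSpan 0 := by
      refine C.powerSpan_zero_le (Q := (C.powerSpan 0).comap
        (starLinearEquiv ℂ (A := C.CuntzPimsner)).toLinearMap)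
        ((C.isClosed_powerSpan 0).preimage continuous_star) (fun a => ?_) hv
      change star (C.jA a) ∈ C.powerSpan 0
      rw [← map_star]
      exact C.jA_mem_powerSpan_zero _
    exact C.powerSpan_zero_le (Q := (C.powerSpan 0).comap (LinearMap.mulRight ℂ w))
      ((C.isClosed_powerSpan 0).preimage (continuous_mul_const w))
      (fun a => C.jA_mul_mem_powerSpan a hw) hstar
  | succ k ih =>
    intro v w hv hw
    -- The adjoint is treated instead, so that v, the factor being expanded, stands on the right.
    have h1 : star w * v ∈ (C.powerSpan 0).comap
        (starLinearEquiv ℂ (A := C.CuntzPimsner)).toLinearMap := by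
      refine mul_mem_of_mem_clspMul _
        ((C.isClosed_powerSpan 0).preimage continuous_star) ?_ hv
      rintro _ ⟨x, rfl⟩ u hu
      change star (star w * (C.jX x * u)) ∈ C.powerSpan 0
      rw [star_mul, star_mul, star_star, mul_assoc]
      exact ih hu (C.star_jX_mul_mem_powerSpan x hw)
    simpa using h1

/-! ### Faithfulness on P_k and isometry in degree zero -/

variable {C}

/-- The c for which every such b satisfies bc = bc* = 0 form a closed star subalgebra. It contains
j_X(x) because j_A(R)j_X(X) is dense in j_X(X). It contains j_X(x)* because b j_X(x)* j_X(x) = b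
j_A(⟨x,x⟩) = 0. So c = b is allowed and bb* = 0. -/
theorem mul_eq_zero_of_mul_jA_eq_zero (hnd : C.Nondegenerate) {b : C.CuntzPimsner}
    (hb : ∀ a, b * C.jA a = 0) : b = 0 := by
  have key : ∀ c b : C.CuntzPimsner, (∀ a, b * C.jA a = 0) → b * c = 0 ∧ b * star c = 0 := by
    intro c
    have hstar {b d : C.CuntzPimsner} (h : b * (star d * d) = 0) : b * star d = 0 := by
      refine CStarRing.mul_star_self_eq_zero_iff _ |>.mp ?_
      rw [star_mul, star_star, mul_assoc, ← mul_assoc (star d), ← mul_assoc, h, zero_mul]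
    refine CuntzPimsner.induction_on' C (P := fun c => ∀ b : C.CuntzPimsner,
      (∀ a, b * C.jA a = 0) → b * c = 0 ∧ b * star c = 0) ?_ ?_ ?_ ?_ ?_ ?_ ?_ c
    · simp only [Set.ofPred_forall]
      refine isClosed_iInter fun b => isClosed_iInter fun _ => ?_
      exact (isClosed_eq (continuous_const_mul b) continuous_const).inter
        (isClosed_eq ((continuous_const_mul b).comp continuous_star) continuous_const)
    · intro a b hb
      exact ⟨hb a, by rw [← map_star]; exact hb _⟩
    · intro x b hb
      refine ⟨?_, hstar (by rw [star_jX_mul_jX]; exact hb _)⟩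
      have hψ : Continuous C.jX := (C.jX.mkContinuous 1 fun x => by
        rw [one_mul]; exact C.univRep.norm_ψ_le x).continuous
      have hx : x ∈ (Submodule.span ℂ {z | ∃ a x, z = C.left a x}).topologicalClosure := by
        rw [hnd]; trivial
      refine Submodule.topologicalClosure_minimal _
        (t := (LinearMap.ker (LinearMap.mulLeft ℂ b ∘ₗ C.jX))) (Submodule.span_le.mpr ?_) ?_ hx
      · rintro _ ⟨a, x, rfl⟩
        change b * C.jX (C.left a x) = 0
        have : C.jX (C.left a x) = C.jA a * C.jX x := C.univRep.map_left a x
        rw [this, ← mul_assoc, hb, zero_mul]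
      · exact isClosed_eq ((continuous_const_mul b).comp hψ) continuous_const
    · intro y z hy hz b hb
      simp [mul_add, hy b hb, hz b hb]
    · intro y z hy hz b hb
      rw [star_mul, ← mul_assoc, ← mul_assoc, (hy b hb).1, (hz b hb).2, zero_mul, zero_mul]
      exact ⟨rfl, rfl⟩
    · intro c y hy b hb
      simp [mul_smul_comm, hy b hb]
    · intro y hy b hb
      rw [star_star]
      exact (hy b hb).symm
  exact CStarRing.mul_star_self_eq_zero_iff _ |>.mp (key b b hb).2

/-- Covariance enters here: j_A(a) = π⁽¹⁾(φ(a)) lies in clsp j_X(X)j_X(X)*. If b kills P_{k+1} then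
each b j_X(x) kills P_k, hence vanishes by induction, and so b j_A(a) = 0. -/
theorem eq_zero_of_mul_powerSpan_eq_zero (hnd : C.Nondegenerate) (hc : C.CompactLeftAction)
    {k : ℕ} : ∀ {b : C.CuntzPimsner}, (∀ v ∈ C.powerSpan k, b * v = 0) → b = 0 := by
  induction k with
  | zero =>
    intro b h
    exact mul_eq_zero_of_mul_jA_eq_zero hnd fun a => h _ (C.jA_mem_powerSpan_zero a)
  | succ k ih =>
    intro b h
    refine mul_eq_zero_of_mul_jA_eq_zero hnd fun a => ?_
    have h1 : C.jA a = C.univRep.induced ⟨C.left a, hc a⟩ :=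
      (C.univRep_covariant a (hc a)).symm
    rw [h1]
    refine mul_eq_zero_of_mem_clspMul ?_ (C.univRep.induced_mem_clspMul _)
    rintro _ ⟨x, rfl⟩
    refine ih fun v hv => ?_
    rw [mul_assoc]
    exact h _ (C.jX_mul_mem_powerSpan x hv)

variable {B : Type*} [NonUnitalCStarAlgebra B] (Θ : C.CuntzPimsner →⋆ₙₐ[ℂ] B)

/-- If Θ c = 0 with c in the stabilizer, then for v in P_k the element (cv)*(cv) lies in P_0 and is
killed by Θ, which is isometric there. So c kills P_k and vanishes by faithfulness. -/
theorem norm_map_of_mem_powerStabilizer (hnd : C.Nondegenerate) (hc : C.CompactLeftAction)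
    (hinj : ∀ a, Θ (C.jA a) = 0 → a = 0) {k : ℕ} {b : C.CuntzPimsner}
    (hb : b ∈ C.powerStabilizer k) : ‖Θ b‖ = ‖b‖ := by
  have hjA : ∀ a, ‖Θ (C.jA a)‖ = ‖a‖ :=
    NonUnitalStarAlgHom.norm_map (Θ.comp C.jA) ((injective_iff_map_eq_zero _).mpr hinj)
  have h0 : ∀ t ∈ C.powerSpan 0, Θ t = 0 → t = 0 := by
    intro t ht h
    have hcl : IsClosed {t : C.CuntzPimsner | ‖t‖ ≤ ‖Θ t‖} :=
      isClosed_le continuous_norm (map_continuous Θ).norm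
    have : ‖t‖ ≤ ‖Θ t‖ := by
      refine closure_minimal ?_ hcl ht
      rintro _ ⟨a, rfl⟩
      exact (C.univRep.norm_π_le a).trans (hjA a).ge
    simpa [h] using this
  refine NonUnitalStarAlgHom.norm_map
    (Θ.comp (NonUnitalStarSubalgebraClass.subtype (C.powerStabilizer k)))
    ((injective_iff_map_eq_zero _).mpr ?_) ⟨b, hb⟩
  rintro ⟨c, hc'⟩ h
  have h' : Θ c = 0 := h
  refine Subtype.ext (eq_zero_of_mul_powerSpan_eq_zero hnd hc (k := k) fun v hv => ?_)
  refine CStarRing.star_mul_self_eq_zero_iff _ |>.mp ?_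
  refine h0 _ (C.star_mul_mem_powerSpan_zero (hc'.1 v hv) (hc'.1 v hv)) ?_
  simp [h']

/-- The graded uniqueness theorem: a star homomorphism from the Cuntz–Pimsner algebra into a
`ℤ`-graded C*-algebra that preserves degrees and is injective on the coefficient algebra is
isometric. -/
theorem isometry_of_isCStarGrading (hnd : C.Nondegenerate) (hc : C.CompactLeftAction)
    (hinj : ∀ a, Θ (C.jA a) = 0 → a = 0) {𝒢 : ℤ → Submodule ℂ B} (h𝒢 : IsCStarGrading 𝒢)
    (hA : ∀ a, Θ (C.jA a) ∈ 𝒢 0) (hX : ∀ x, Θ (C.jX x) ∈ 𝒢 1) : Isometry Θ := by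
  obtain ⟨E, -, -, hE, hE0, hEn⟩ := h𝒢.exists_expectation
  have hword : ∀ n w, C.IsWord n w → Θ w ∈ 𝒢 n := by
    intro n w hw
    induction hw with
    | jA a => exact hA a
    | jX x => exact hX x
    | star_jX x =>
      rw [map_star, h𝒢.star_mem_iff, star_star]
      exact hX x
    | mul m n v w _ _ hv hw =>
      rw [map_mul]
      exact h𝒢.mul_mem _ _ _ hv _ hw
  have hdeg : ∀ n, ∀ b ∈ C.wordSpan n, Θ b ∈ 𝒢 n := fun n b hb =>
    Submodule.span_le (p := (𝒢 n).comap (Θ : C.CuntzPimsner →ₗ[ℂ] B)) |>.mpr (hword n) hb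
  refine isometry_of_isometry_degree_zero C.mul_mem_wordSpan C.star_mem_wordSpan Θ ?_ E hE
    (fun b hb => hE0 _ (hdeg 0 b hb)) (fun n hn b hb => hEn n hn _ (hdeg n b hb))
    C.dense_wordSpan
  intro b hb
  obtain ⟨k₁, h1⟩ := C.exists_mul_mem_powerSpan hb
  obtain ⟨k₂, h2⟩ := C.exists_mul_mem_powerSpan (b := star b)
    (by simpa using C.star_mem_wordSpan 0 b hb)
  -- One k must serve both b and its adjoint.
  exact norm_map_of_mem_powerStabilizer Θ hnd hc hinj (k := max k₁ k₂)
    ⟨h1 _ (le_max_left _ _), h2 _ (le_max_right _ _)⟩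

end uniqueness

end Correspondence

/-! ### Correspondences inside a C*-algebra -/

/-- Positivity is detected by injective star homomorphisms. -/
theorem CStarPos.of_map {A B : Type*} [NonUnitalCStarAlgebra A] [NonUnitalCStarAlgebra B]
    (φ : A →⋆ₙₐ[ℂ] B) (hφ : Function.Injective φ) {a : A} (h : CStarPos (φ a)) : CStarPos a := by
  let _ : PartialOrder A := CStarAlgebra.spectralOrder _
  have _ : StarOrderedRing A := CStarAlgebra.spectralOrderedRing _
  let _ : PartialOrder B := CStarAlgebra.spectralOrder _
  have _ : StarOrderedRing B := CStarAlgebra.spectralOrderedRing _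
  have h0 : 0 ≤ φ a := CStarAlgebra.nonneg_iff_eq_star_mul_self.mpr h
  have hsa : IsSelfAdjoint a := hφ (by rw [map_star, h0.isSelfAdjoint.star_eq])
  refine CStarAlgebra.nonneg_iff_eq_star_mul_self.mp ?_
  -- The functional calculus commutes with φ, so φ(a⁻) = φ(a)⁻ = 0.
  rw [← CFC.negPart_eq_zero_iff a hsa]
  refine hφ ?_
  rw [map_zero, CFC.negPart_def, NonUnitalStarAlgHom.map_cfcₙ φ _ a (by fun_prop) (by simp)
    (map_continuous φ) hsa h0.isSelfAdjoint, ← CFC.negPart_def,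
    CFC.negPart_eq_zero_iff _ h0.isSelfAdjoint]
  exact h0

section subspace

variable {A : Type u} [NonUnitalCStarAlgebra A] (R : NonUnitalStarSubalgebra ℂ A)
  [IsClosed (R : Set A)] (X : Submodule ℂ A) (hXc : IsClosed (X : Set A))
  (hr : ∀ x ∈ X, ∀ a ∈ R, x * a ∈ X) (hl : ∀ a ∈ R, ∀ x ∈ X, a * x ∈ X)
  (hin : ∀ x ∈ X, ∀ y ∈ X, star x * y ∈ R)

/-- A closed subspace `X` of a C*-algebra with `X R ⊆ X`, `R X ⊆ X` and `X* X ⊆ R`, as a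
C*-correspondence over `R`. -/
def subspaceCorrespondence : Correspondence R X where
  right := LinearMap.mk₂ ℂ (fun x a => ⟨x * a, hr x x.2 a a.2⟩)
    (fun x y a => Subtype.ext (add_mul (x : A) y a))
    (fun c x a => Subtype.ext (smul_mul_assoc c (x : A) (a : A)))
    (fun x a b => Subtype.ext (mul_add (x : A) a b))
    (fun c x a => Subtype.ext (mul_smul_comm c (x : A) (a : A)))
  right_mul x a b := Subtype.ext (mul_assoc (x : A) a b).symm
  inner := LinearMap.mk₂'ₛₗ (starRingEnd ℂ) (RingHom.id ℂ)
    (fun x y => ⟨star (x : A) * y, hin x x.2 y y.2⟩)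
    (fun x y z => Subtype.ext (by simp [add_mul]))
    (fun c x y => Subtype.ext (by simp [smul_mul_assoc]))
    (fun x y z => Subtype.ext (by simp [mul_add]))
    (fun c x y => Subtype.ext (by simp [mul_smul_comm]))
  inner_right x y a := Subtype.ext (mul_assoc (star (x : A)) y a).symm
  star_inner x y := Subtype.ext (by simp)
  -- Here x need not belong to R, so x* x is visibly positive only in A, while a factorization
  -- inside R is required.
  inner_self_pos x := CStarPos.of_map (NonUnitalStarSubalgebraClass.subtype R)
    Subtype.val_injective ⟨x, rfl⟩
  inner_self_eq_zero x h :=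
    Subtype.ext (CStarRing.star_mul_self_eq_zero_iff _ |>.mp (congrArg Subtype.val h))
  norm_sq x := by
    rw [sq]
    exact (CStarRing.norm_star_mul_self (x := (x : A))).symm
  complete := hXc.completeSpace_coe
  left :=
    { toFun := fun a => LinearMap.mkContinuous
        { toFun := fun x => ⟨a * x, hl a a.2 x x.2⟩
          map_add' := fun x y => Subtype.ext (mul_add (a : A) x y)
          map_smul' := fun c x => Subtype.ext (mul_smul_comm c (a : A) (x : A)) }
        ‖(a : A)‖ fun x => norm_mul_le (a : A) x
      map_add' := fun a b => by ext x; exact add_mul (a : A) b x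
      map_smul' := fun c a => by ext x; exact smul_mul_assoc c (a : A) (x : A) }
  left_mul a b x := Subtype.ext (mul_assoc (a : A) b x)
  left_right a x b := Subtype.ext (mul_assoc (a : A) x b).symm
  inner_left a x y := Subtype.ext (by
    change star ((a : A) * x) * y = star (x : A) * (star (a : A) * y)
    rw [star_mul, mul_assoc])

namespace subspaceCorrespondence

local notation "𝒞" => subspaceCorrespondence R X hXc hr hl hin

theorem coe_right (x : X) (a : R) : ((𝒞).right x a : A) = x * a := rfl

theorem coe_inner (x y : X) : ((𝒞).inner x y : A) = star (x : A) * y := rfl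

theorem nondegenerate (h : (X : Set A) ⊆ clspMul (R : Set A) (X : Set A)) :
    (𝒞).Nondegenerate := by
  rw [Correspondence.Nondegenerate, eq_top_iff]
  intro x _
  change x ∈ closure _
  rw [closure_subtype]
  refine closure_mono ?_ (h x.2)
  refine Submodule.span_le (p := Submodule.map X.subtype _) |>.mpr ?_
  rintro _ ⟨a, ha, y, hy, rfl⟩
  exact ⟨⟨_, hl a ha y hy⟩, Submodule.subset_span ⟨⟨a, ha⟩, ⟨y, hy⟩, rfl⟩, rfl⟩

theorem full (h : (R : Set A) ⊆ clspMul (star (X : Set A)) (X : Set A)) : (𝒞).Full := by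
  rw [Correspondence.Full, eq_top_iff]
  intro a _
  change a ∈ closure _
  rw [closure_subtype]
  refine closure_mono ?_ (h a.2)
  refine Submodule.span_le (p := Submodule.map
    (NonUnitalStarSubalgebraClass.subtype R : R →ₗ[ℂ] A) _) |>.mpr ?_
  rintro _ ⟨x, hx, y, hy, rfl⟩
  refine ⟨⟨x * y, ?_⟩, Submodule.subset_span ⟨⟨star x, hx⟩, ⟨y, hy⟩, ?_⟩, rfl⟩
  · simpa using hin (star x) hx y hy
  · exact Subtype.ext (by simp [coe_inner])

/-- If aX = 0 then a annihilates clsp XX*, which contains a*; so aa* = 0. -/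
theorem injectiveLeftAction
    (h : (R : Set A) ⊆ clspMul (X : Set A) (star (X : Set A))) : (𝒞).InjectiveLeftAction := by
  intro a ha
  refine Subtype.ext (CStarRing.mul_star_self_eq_zero_iff _ |>.mp ?_)
  refine mul_eq_zero_of_mem_clspMul (fun x hx => ?_) (h (star_mem a.2))
  exact congrArg Subtype.val (DFunLike.congr_fun ha (⟨x, hx⟩ : X))

/-- A finite sum s of products xy* acts on X as the corresponding sum T of rank-one operators, even
when s is not in R, and ‖φ(a) - T‖ ≤ ‖a - s‖. -/
theorem compactLeftAction
    (h : (R : Set A) ⊆ clspMul (X : Set A) (star (X : Set A))) : (𝒞).CompactLeftAction := by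
  have hspan : ∀ s ∈ Submodule.span ℂ {a : A | ∃ x ∈ (X : Set A), ∃ t ∈ star (X : Set A),
      a = x * t}, ∃ T ∈ Submodule.span ℂ {T | ∃ x y, T = (𝒞).theta x y},
      ∀ z, (T z : A) = s * z := by
    intro s hs
    induction hs using Submodule.span_induction with
    | mem s hs =>
      obtain ⟨x, hx, t, ht, rfl⟩ := hs
      refine ⟨_, Submodule.subset_span ⟨⟨x, hx⟩, ⟨star t, ht⟩, rfl⟩, fun z => ?_⟩
      rw [Correspondence.theta_apply, coe_right, coe_inner]
      simp [mul_assoc]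
    | zero => exact ⟨0, zero_mem _, by simp⟩
    | add s t _ _ hs ht =>
      obtain ⟨S, hS, h1⟩ := hs
      obtain ⟨T, hT, h2⟩ := ht
      exact ⟨S + T, add_mem hS hT, by simp [h1, h2, add_mul]⟩
    | smul c s _ hs =>
      obtain ⟨S, hS, h1⟩ := hs
      exact ⟨c • S, Submodule.smul_mem _ _ hS, by simp [h1, smul_mul_assoc]⟩
  intro a
  change _ ∈ closure _
  rw [Metric.mem_closure_iff]
  intro ε hε
  obtain ⟨s, hs, hlt⟩ := Metric.mem_closure_iff.mp (h a.2) ε hε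
  obtain ⟨T, hT, hTs⟩ := hspan s hs
  refine ⟨T, hT, lt_of_le_of_lt ?_ hlt⟩
  rw [dist_eq_norm, dist_eq_norm]
  refine ContinuousLinearMap.opNorm_le_bound _ (norm_nonneg _) fun z => ?_
  have hz : (((𝒞).left a - T) z : A) = ((a : A) - s) * z := by
    rw [sub_mul, ← hTs]
    rfl
  change ‖(((𝒞).left a - T) z : A)‖ ≤ _
  rw [hz]
  exact norm_mul_le _ _

/-- The representation of the correspondence given by the inclusions. -/
def inclusion : (𝒞).Rep A where
  π := NonUnitalStarSubalgebraClass.subtype R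
  ψ := X.subtype
  map_left _ _ := rfl
  map_right _ _ := rfl
  map_inner _ _ := rfl

/-- The elements π⁽¹⁾(φ(a)) and a both lie in clsp XX* and multiply X identically from the left.
Their difference d kills X, and d* lies in clsp XX*, so dd* = 0. -/
theorem inclusion_covariant
    (h : (R : Set A) ⊆ clspMul (X : Set A) (star (X : Set A))) :
    (inclusion R X hXc hr hl hin).Covariant := by
  intro a ha
  set ρ := inclusion R X hXc hr hl hin
  have hrange : Set.range ρ.ψ = (X : Set A) := Subtype.range_coe
  have hmem := ρ.induced_mem_clspMul ⟨_, ha⟩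
  rw [hrange] at hmem
  have hstar : ∀ t ∈ clspMul (X : Set A) (star (X : Set A)),
      star t ∈ clspMul (X : Set A) (star (X : Set A)) := by
    refine fun t ht => clspMul_le (P := (clspMul (X : Set A) (star (X : Set A))).comap
      (starLinearEquiv ℂ (A := A)).toLinearMap)
      ((isClosed_clspMul _ _).preimage continuous_star) (fun x hx t ht => ?_) ht
    change star (x * t) ∈ clspMul (X : Set A) (star (X : Set A))
    rw [star_mul]
    exact mul_mem_clspMul ht (by simpa using hx)
  rw [← sub_eq_zero, ← CStarRing.mul_star_self_eq_zero_iff]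
  refine mul_eq_zero_of_mem_clspMul (fun x hx => ?_) (hstar _ (sub_mem hmem (h a.2)))
  rw [sub_mul, sub_eq_zero]
  exact ρ.induced_mul_ψ ⟨_, ha⟩ ⟨x, hx⟩

end subspaceCorrespondence

end subspace

/-- If the coefficient algebra has an approximate unit in `clspMul X X*`, it is contained in it. -/
theorem subset_clspMul_star {A : Type*} [NonUnitalCStarAlgebra A]
    {R : NonUnitalStarSubalgebra ℂ A} {X : Submodule ℂ A}
    (hl : ∀ a ∈ R, ∀ x ∈ X, a * x ∈ X)
    (h : ∃ l : Filter R, l.IsApproximateUnit ∧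
      ∀ᶠ e : R in l, (e : A) ∈ clspMul (X : Set A) (star (X : Set A))) :
    (R : Set A) ⊆ clspMul (X : Set A) (star (X : Set A)) := by
  obtain ⟨l, hl', he⟩ := h
  intro a ha
  have := hl'.neBot
  have hlim : Tendsto (fun e : R => (a * e : A)) l (𝓝 a) :=
    (continuous_subtype_val.tendsto _).comp (hl'.tendsto_mul_left ⟨a, ha⟩)
  refine (isClosed_clspMul _ _).mem_of_tendsto hlim (he.mono fun e he => ?_)
  refine mul_mem_of_mem_clspMul a (isClosed_clspMul _ _) (fun x hx t ht => ?_) he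
  rw [← mul_assoc]
  exact mul_mem_clspMul (hl a ha x hx) ht

/-- A strongly `ℤ`-graded C*-algebra is generated by its subspace of degree one. -/
theorem IsStrongCStarGrading.eq_top {A : Type*} [NonUnitalCStarAlgebra A]
    {𝒢 : ℤ → Submodule ℂ A} (h𝒢 : IsStrongCStarGrading 𝒢) {S : NonUnitalStarSubalgebra ℂ A}
    (hS : IsClosed (S : Set A)) (h1 : ∀ a ∈ 𝒢 1, a ∈ S) (a : A) : a ∈ S := by
  have hmul : ∀ m n, (∀ a ∈ 𝒢 m, a ∈ S) → (∀ a ∈ 𝒢 n, a ∈ S) → ∀ a ∈ 𝒢 (m + n), a ∈ S := by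
    intro m n hm hn a ha
    rw [← h𝒢.strong] at ha
    exact clspMul_le (P := S.toSubmodule) hS (fun s hs t ht => S.mul_mem (hm s hs) (hn t ht)) ha
  have hneg : ∀ n, (∀ a ∈ 𝒢 n, a ∈ S) → ∀ a ∈ 𝒢 (-n), a ∈ S := by
    intro n hn a ha
    simpa using star_mem (hn _ ((h𝒢.star_mem_iff n a).mp ha))
  have hnat : ∀ n : ℕ, ∀ a ∈ 𝒢 n, a ∈ S := by
    intro n
    induction n with
    -- Strongness makes degree zero the closed span of A_1 A_{-1}.
    | zero => exact hmul 1 (-1) h1 (hneg 1 h1)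
    | succ n ih => exact_mod_cast hmul n 1 ih h1
  have hint : ∀ n : ℤ, 𝒢 n ≤ S.toSubmodule := by
    intro n
    obtain ⟨k, rfl | rfl⟩ := n.eq_nat_or_neg
    · exact hnat k
    · exact hneg _ (hnat k)
  have : (⨆ n, 𝒢 n).topologicalClosure ≤ S.toSubmodule :=
    Submodule.topologicalClosure_minimal _ (iSup_le hint) hS
  rw [h𝒢.dense] at this
  exact this trivial

end

/-! ### Proof of the lemma -/

theorem mainTheorem4 {A : Type u} [NonUnitalCStarAlgebra A]
    (𝒢 : ℤ → Submodule ℂ A) (h𝒢 : IsStrongCStarGrading 𝒢)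
    (R : NonUnitalStarSubalgebra ℂ A) [hRc : IsClosed (R : Set A)]
    (hR0 : ∀ a ∈ R, a ∈ 𝒢 0) (hRσ : SigmaUnital R)
    (X : Submodule ℂ A) (hXc : IsClosed (X : Set A)) (hX1 : X ≤ 𝒢 1)
    (h1r : ∀ x ∈ X, ∀ a ∈ R, x * a ∈ X)
    (h1l : clspMul (R : Set A) (X : Set A) = X)
    (h2 : (R : Set A) = clspMul (star (X : Set A)) (X : Set A))
    (h3 : ∃ l : Filter R, l.IsApproximateUnit ∧
      ∀ᶠ e : R in l, (e : A) ∈ clspMul (X : Set A) (star (X : Set A)))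
    (h4 : ∀ a ∈ 𝒢 1, a ∈ cstarGen (X : Set A)) :
    ∃ C : Correspondence R X,
      (∀ (a : R) (x : X), (C.left a x : A) = (a : A) * (x : A)) ∧
      (∀ (x : X) (a : R), (C.right x a : A) = (x : A) * (a : A)) ∧
      (∀ x y : X, (C.inner x y : A) = star (x : A) * (y : A)) ∧
      C.Nondegenerate ∧ C.Full ∧ C.CompactLeftAction ∧ C.InjectiveLeftAction ∧
      ∃! Ψ : A ≃⋆ₐ[ℂ] C.CuntzPimsner,
        (∀ x : X, Ψ (x : A) = C.jX x) ∧ (∀ a : R, Ψ (a : A) = C.jA a) := by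
  have hl : ∀ a ∈ R, ∀ x ∈ X, a * x ∈ X := fun a ha x hx => by
    rw [← h1l]
    exact mul_mem_clspMul ha hx
  have hin : ∀ x ∈ X, ∀ y ∈ X, star x * y ∈ R := fun x hx y hy => by
    rw [← SetLike.mem_coe, h2]
    exact mul_mem_clspMul (by simpa using hx) hy
  have hRX := subset_clspMul_star hl h3
  set C := subspaceCorrespondence R X hXc h1r hl hin
  have hnd : C.Nondegenerate :=
    subspaceCorrespondence.nondegenerate R X hXc h1r hl hin (by rw [h1l])
  have hc : C.CompactLeftAction :=
    subspaceCorrespondence.compactLeftAction R X hXc h1r hl hin hRX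
  refine ⟨C, fun _ _ => rfl, fun _ _ => rfl, fun _ _ => rfl, hnd,
    subspaceCorrespondence.full R X hXc h1r hl hin h2.subset, hc,
    subspaceCorrespondence.injectiveLeftAction R X hXc h1r hl hin hRX, ?_⟩
  obtain ⟨Θ, ⟨hΘA, hΘX⟩, -⟩ := C.existsUnique_lift _
    (subspaceCorrespondence.inclusion_covariant R X hXc h1r hl hin hRX)
  have hΘA' : ∀ a : R, Θ (C.jA a) = (a : A) := hΘA
  have hΘX' : ∀ x : X, Θ (C.jX x) = (x : A) := hΘX
  have hiso : Isometry Θ := Correspondence.isometry_of_isCStarGrading Θ hnd hc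
    (fun a ha => Subtype.ext ((hΘA' a).symm.trans ha)) h𝒢.toIsCStarGrading
    (fun a => by rw [hΘA']; exact hR0 a a.2) (fun x => by rw [hΘX']; exact hX1 x.2)
  -- A closed star subalgebra containing X contains C*(X), hence A_1, hence A. This serves
  -- surjectivity, with S the closed range of the isometry Θ, and uniqueness, with S an equalizer.
  have htop : ∀ S : NonUnitalStarSubalgebra ℂ A, IsClosed (S : Set A) → (∀ x ∈ X, x ∈ S) →
      ∀ a, a ∈ S := fun S hS hXS => h𝒢.eq_top hS fun a ha =>
    NonUnitalStarSubalgebra.topologicalClosure_minimal _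
      (NonUnitalStarAlgebra.adjoin_le hXS) hS (h4 a ha)
  have hsurj : Function.Surjective Θ := fun a =>
    htop (NonUnitalStarAlgHom.range Θ) hiso.isClosedEmbedding.isClosed_range
      (fun x hx => ⟨C.jX ⟨x, hx⟩, hΘX' _⟩) a
  set Φ := StarAlgEquiv.ofBijective Θ ⟨hiso.injective, hsurj⟩
  have hΦ : ∀ z, Φ.symm (Θ z) = z := Φ.symm_apply_apply
  refine ⟨Φ.symm, ⟨fun x => ?_, fun a => ?_⟩, ?_⟩
  · rw [← hΘX', hΦ]
  · rw [← hΘA', hΦ]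
  · rintro Ψ ⟨hΨX, -⟩
    refine StarAlgEquiv.ext fun a => ?_
    have hcont : ∀ Ψ : A ≃⋆ₐ[ℂ] C.CuntzPimsner, Continuous Ψ := fun Ψ => map_continuous Ψ
    have := htop (NonUnitalStarAlgHom.equalizer Ψ Φ.symm)
      (isClosed_eq (hcont Ψ) (hcont Φ.symm)) (fun x hx => by
        change Ψ x = Φ.symm x
        rw [hΨX ⟨x, hx⟩, ← hΦ (C.jX ⟨x, hx⟩), hΘX']) a
    exact this
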